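/- **Setting.** For a finite simple graph $G=(V,E)$ on $n$ vertices let $X_i(G)$ be the set of $i$-faces of its clique complex, i.e. of the cliques with $i+1$ vertices. Fix $d\ge 1$. For a face $\sigma$ let $\deg_d(\sigma)$ be the number of $d$-faces containing $\sigma$; for $C\subseteq X_i(G)$ let $\mathrm{Vol}_d(C)=\sum_{\tau\in C}\deg_d(\tau)$ and $\|C\|_d=\mathrm{Vol}_d(C)/\mathrm{Vol}_d(X_i(G))$. For $S,S'\subseteq X_i(G)$ let $\mathbb F(S,S')$ be the set of $(i+1)$-faces that contain a face of $S$ and a face of $S'$. For $C\subseteq X_i(G)$ put $$\Psi_{d,C}(S)=\frac{\|\mathbb F(S,C\setminus S)\|_d}{\min\{\|S\|_d,\|C\setminus S\|_d\}}\ (S\subseteq C),\qquad \Psi_d(C)=\min_{\substack{S\subsetneq C\\ 0<\mathrm{Vol}_d(S)\le \mathrm{Vol}_d(C)/2}}\frac{\|\mathbb F(S,C\setminus S)\|_d}{\|S\|_d},$$ where $0/0=0$ in $\Psi_{d,C}(S)$ (so $\Psi_{d,C}(C)=0$) and an empty minimum is $+\infty$. The graph $G$ has a *$d$-dimension $(k,\psi_{in},\psi_{out})$-cluster*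 if $V$ has a partition into $h$ nonempty parts $P_1,\dots,P_h$, $1\le h\le k$, with $\Psi_d(X_r(G[P_j]))\ge\psi_{in}$ and $\Psi_{d,X_r(G)}(X_r(G[P_j]))\le\psi_{out}$ for all $1\le j\le h$ and $0\le r<d$ (all volumes and expander faces taken in $G$). $G$ is *$\varepsilon$-far* from having one if no graph obtained from $G$ by inserting or deleting at most $\varepsilon d_{max}n$ edges has one. A graph on $\{1,\dots,n\}$ with maximum degree at most $d_{max}$ is accessed by a neighbor query oracle: the reply to $(v,i)$ is the $i$-th neighbor of $v$ in an arbitrary predetermined order, or NULL if $v$ has fewer than $i$ neighbors. A *tester of $d$-dimension $(k,\psi_{in},\psi_{out},\varepsilon)$-clusterability* is a randomized adaptive query algorithm (which may depend on $n$ and on all parameters) that, for each such graph and order, accepts with probability at least $2/3$ if the graph has a $d$-dimension $(k,\psi_{in},\psi_{out})$-cluster, and rejects with probability at least $2/3$ if it is $\varepsilon$-far from having one. Its query complexity is the maximal number of queries it makes, over all such graphs, orders and coin tosses. **Theorem.** With neighbor query oracle access, testing $d$-dimension $(k,\psi_{in},\psi_{out},\varepsilon)$-clusterability on bounded-degree graphs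 needs $\Omega(\sqrt n)$ queries, for all dimensions $d$, all $k$, all sufficiently large degree bounds and all sufficiently small $\psi_{in}$ and $\varepsilon$. Precisely: for every $d\ge1$ there are $D_0\in\mathbb N$ and $\psi_0>0$ such that for every $k\ge1$ there is $c>0$ such that for all $d_{max}\ge D_0$ and all $\psi_{in}\in(0,\psi_0]$ there is $\varepsilon_0>0$ such that for every $\varepsilon\in(0,\varepsilon_0]$ there is $N$ such that for all $n\ge N$ and all $\psi_{out}\ge0$ (in particular those with $\psi_{out}=O(\frac{\varepsilon^4}{\log n}\psi_{in}^2)$), every tester of $d$-dimension $(k,\psi_{in},\psi_{out},\varepsilon)$-clusterability on $n$-vertex graphs of maximum degree at most $d_{max}$ has query complexity at least $c\sqrt n$. -/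

import Mathlib

namespace HigherOrderClusterability

noncomputable section

/-! ### The clique complex of a graph and conductance of cochains -/

open Classical in
/-- The `i`-faces of the clique complex of `G`: the cliques with `i + 1` vertices. In particular the
`0`-faces are the vertices and the `1`-faces are the edges of `G`. -/
def faces {V : Type*} [Fintype V] (G : SimpleGraph V) (i : ℕ) : Finset (Finset V) :=
  Finset.univ.filter fun s => G.IsNClique (i + 1) s

open Classical in
/-- The `i`-faces of `G` all of whose vertices lie in `A`, i.e. the `i`-faces of the clique complex
of the induced graph `G[A]`, viewed inside the clique complex of `G`. -/
def facesIn {V : Type*} [Fintype V] (G : SimpleGraph V) (i : ℕ) (A : Finset V) :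
    Finset (Finset V) :=
  (faces G i).filter fun s => s ⊆ A

open Classical in
/-- `deg_d(σ)`: the number of `d`-faces that contain `σ`. -/
def faceDegree {V : Type*} [Fintype V] (G : SimpleGraph V) (d : ℕ) (σ : Finset V) : ℕ :=
  ((faces G d).filter fun ρ => σ ⊆ ρ).card

/-- `Vol_d(C)`: the sum of the degrees `deg_d` over the faces in the cochain `C`. -/
def vol {V : Type*} [Fintype V] (G : SimpleGraph V) (d : ℕ) (C : Finset (Finset V)) : ℕ :=
  ∑ τ ∈ C, faceDegree G d τ

/-- `‖C‖_d = Vol_d(C) / Vol_d(X_i)` for an `i`-cochain `C`. -/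
def cochainNorm {V : Type*} [Fintype V] (G : SimpleGraph V) (d i : ℕ)
    (C : Finset (Finset V)) : ℝ :=
  (vol G d C : ℝ) / (vol G d (faces G i) : ℝ)

open Classical in
/-- The expander face `𝔽(S, S')` of two `i`-cochains: the `(i+1)`-faces that contain a face of `S`
and a face of `S'`. -/
def expanderFace {V : Type*} [Fintype V] (G : SimpleGraph V) (i : ℕ)
    (S S' : Finset (Finset V)) : Finset (Finset V) :=
  (faces G (i + 1)).filter fun σ => ∃ τ ∈ S, ∃ τ' ∈ S', τ ⊆ σ ∧ τ' ⊆ σ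

open Classical in
/-- The normalized external conductance `Ψ_{d,C}(S)` of `S` on `C`. If `S` or `C \ S` has volume
zero, then no `d`-face is cut and the value is `0 / 0 = 0`; in particular it is `0` for `S = C`. -/
def externalConductance {V : Type*} [Fintype V] (G : SimpleGraph V) (d i : ℕ)
    (C S : Finset (Finset V)) : ℝ :=
  cochainNorm G d (i + 1) (expanderFace G i S (C \ S)) /
    min (cochainNorm G d i S) (cochainNorm G d i (C \ S))

open Classical in
/-- The normalized internal conductance of the `i`-cochain `C`: the minimum of
`‖𝔽(S, C \ S)‖_d / ‖S‖_d` over the proper subsets `S` of `C` with `0 < Vol_d(S) ≤ Vol_d(C) / 2`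
(for volume zero the quotient has no meaning), and `⊤` if there is no such `S`. -/
def internalConductance {V : Type*} [Fintype V] (G : SimpleGraph V) (d i : ℕ)
    (C : Finset (Finset V)) : EReal :=
  ⨅ S : Finset (Finset V), ⨅ _ : S ⊂ C ∧ 0 < vol G d S ∧ 2 * vol G d S ≤ vol G d C,
    ((cochainNorm G d (i + 1) (expanderFace G i S (C \ S)) / cochainNorm G d i S : ℝ) : EReal)

/-- `G` has a `d`-dimension `(k, ψ_in, ψ_out)`-cluster: there is a partition of the vertex set into
at least one and at most `k` parts, all of which satisfy, in each dimension `r < d`, the bounds on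
the internal and the external conductance. -/
def HasCluster {V : Type*} [Fintype V] [DecidableEq V] (G : SimpleGraph V) (d k : ℕ)
    (ψin ψout : ℝ) : Prop :=
  ∃ P : Finpartition (Finset.univ : Finset V), 1 ≤ P.parts.card ∧ P.parts.card ≤ k ∧
    ∀ A ∈ P.parts, ∀ r < d,
      (ψin : EReal) ≤ internalConductance G d r (facesIn G r A) ∧
      externalConductance G d r (faces G r) (facesIn G r A) ≤ ψout

/-- `G` is `ε`-far from having a `d`-dimension `(k, ψ_in, ψ_out)`-cluster: no graph that arises from
`G` by inserting or deleting at most `ε * dmax * n` edges has one. -/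
def IsFar {V : Type*} [Fintype V] [DecidableEq V] (G : SimpleGraph V) (d k dmax : ℕ)
    (ψin ψout ε : ℝ) : Prop :=
  ∀ H : SimpleGraph V,
    ((symmDiff G.edgeSet H.edgeSet).ncard : ℝ) ≤ ε * dmax * Fintype.card V →
      ¬ HasCluster H d k ψin ψout

/-! ### Randomized algorithms with neighbor queries -/

/-- A deterministic adaptive algorithm with neighbor queries on the vertex set `Fin n`, as a decision
tree: it stops with an output, or it queries an index pair `(v, i)` and continues depending on the
reply. -/
inductive QueryAlg (n : ℕ) : Type
  | output (b : Bool) : QueryAlg n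
  | query (v : Fin n) (i : ℕ) (next : Option (Fin n) → QueryAlg n) : QueryAlg n

/-- The output of the algorithm when the queries are answered by `O`. -/
def QueryAlg.run {n : ℕ} (O : Fin n → ℕ → Option (Fin n)) : QueryAlg n → Bool
  | .output b => b
  | .query v i next => (next (O v i)).run O

/-- The number of queries that the algorithm makes when the queries are answered by `O`. -/
def QueryAlg.queries {n : ℕ} (O : Fin n → ℕ → Option (Fin n)) : QueryAlg n → ℕ
  | .output _ => 0
  | .query v i next => (next (O v i)).queries O + 1

/-- `L v` lists the neighbors of `v` in `G`, each exactly once, in some order. -/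
def IsNeighborOrder {n : ℕ} (G : SimpleGraph (Fin n)) (L : Fin n → List (Fin n)) : Prop :=
  ∀ v, (L v).Nodup ∧ ∀ u, u ∈ L v ↔ G.Adj v u

/-- The neighbor query oracle: the reply to `(v, i)` is the `i`-th neighbor of `v` in the
predetermined order (counted from `0`), or `none` if `v` has too few neighbors. -/
def neighborOracle {n : ℕ} (L : Fin n → List (Fin n)) (v : Fin n) (i : ℕ) : Option (Fin n) :=
  (L v)[i]?

/-- Every vertex of `G` has at most `D` neighbors. -/
def DegreeAtMost {n : ℕ} (G : SimpleGraph (Fin n)) (D : ℕ) : Prop :=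
  ∀ v, (G.neighborSet v).ncard ≤ D

/-- The randomized algorithm `T` (a random deterministic algorithm) tests `d`-dimension
`(k, ψ_in, ψ_out, ε)`-clusterability of graphs with `n` vertices and maximum degree at most `dmax`:
for each such graph and each order of the neighbors, it accepts with probability at least `2/3` if
the graph has a cluster, and it rejects with probability at least `2/3` if the graph is
`ε`-far from having one. -/
def IsClusterabilityTester {n : ℕ} (T : PMF (QueryAlg n)) (d k dmax : ℕ) (ψin ψout ε : ℝ) : Prop :=
  ∀ (G : SimpleGraph (Fin n)) (L : Fin n → List (Fin n)),
    DegreeAtMost G dmax → IsNeighborOrder G L →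
      (HasCluster G d k ψin ψout →
        (2 / 3 : ENNReal) ≤ (T.map (QueryAlg.run (neighborOracle L))) true) ∧
      (IsFar G d k dmax ψin ψout ε →
        (2 / 3 : ENNReal) ≤ (T.map (QueryAlg.run (neighborOracle L))) false)

/-- On every graph with maximum degree at most `dmax`, for every order of the neighbors and every
outcome of the coins, `T` makes at most `q` queries. -/
def MakesAtMostQueries {n : ℕ} (T : PMF (QueryAlg n)) (dmax q : ℕ) : Prop :=
  ∀ (G : SimpleGraph (Fin n)) (L : Fin n → List (Fin n)),
    DegreeAtMost G dmax → IsNeighborOrder G L →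
      ∀ t ∈ T.support, t.queries (neighborOracle L) ≤ q

end

end HigherOrderClusterability

namespace HigherOrderClusterability

open Finset

/-! ### Volumes of cochains and passage between norms and volumes -/

section Volume

variable {V : Type*}

/-! The bound comes from two random families of graphs that few queries cannot tell apart. Both are
blowups of 24 permutations of a set `X` of `(k + 1) * M` points, where `M` is of order `n`. The
blowup takes two copies of `X`, replaces each point by a clique of 24 blocks of `d` vertices, and
joins the `b`-th block over `x` completely to the `b`-th block over `π b x` on the other side. The
remaining vertices are isolated.

In the first family the permutations are uniform. With probability at least 3/4 they and their
inverses expand (`card_isExpanding_ge`), and then the whole vertex set is a single cluster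
(`hasCluster_blowup`). The clique complex is covered by cells, namely the cliques over a point and
the unions of two joined blocks. A set of faces either cuts many cells or separates the cells into
two classes, which expansion forbids (`IsCellCover.internalConductance_ge`).

In the second family the permutations respect a hidden balanced coloring of both copies with `k + 1`
colors. The graph then has `k + 1` large pieces without edges between them. Any partition into at
most `k` parts puts large shares of two pieces into the same part, even after few edge changes, so
the graph is far from clusterable (`isFar_blowup`).

A reply reveals at most one value of one permutation. For any `r ≤ q` prescribed values, the
probability of these values in the first family is at most 4/3 times that in the second, provided
that `12 * q ^ 2 ≤ M` (`card_extends_le_coloredPerms`). Summing over the leaves of a decision tree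
(`card_run_le`), the acceptance probabilities obey the same inequality. A tester accepts the first
family with probability at least `3/4 * 2/3 = 1/2` and the second with at most `1/3`, but `4/3 * 1/3
< 1/2`. Hence `M < 12 * q ^ 2`. -/

theorem isNClique_of_subset {G : SimpleGraph V} {Q σ : Finset V} (hQ : G.IsClique (Q : Set V))
    (hσ : σ ⊆ Q) {n : ℕ} (hn : σ.card = n) : G.IsNClique n σ :=
  ⟨hQ.subset (by exact_mod_cast hσ), hn⟩

variable [Fintype V]

theorem mem_faces {G : SimpleGraph V} {i : ℕ} {σ : Finset V} :
    σ ∈ faces G i ↔ G.IsNClique (i + 1) σ := by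
  simp [faces]

-- Double counting of pairs of a `d`-face and an `r`-face inside it. It follows that the normalizing
-- volumes in consecutive dimensions differ by factors depending only on `d`, so conductances can be
-- estimated by plain ratios of volumes.
open Classical in
theorem vol_faces (G : SimpleGraph V) (d r : ℕ) :
    vol G d (faces G r) = (d + 1).choose (r + 1) * (faces G d).card := by
  unfold vol faceDegree
  have h := sum_card_bipartiteAbove_eq_sum_card_bipartiteBelow
    (s := faces G r) (t := faces G d) (fun τ ρ : Finset V => τ ⊆ ρ)
  unfold bipartiteAbove bipartiteBelow at h
  rw [h, mul_comm, ← smul_eq_mul, ← sum_const]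
  refine sum_congr rfl fun ρ hρ => ?_
  have hρ' := mem_faces.1 hρ
  rw [← hρ'.card_eq, ← card_powersetCard]
  congr 1
  ext τ
  simp only [mem_filter, mem_powersetCard, mem_faces]
  exact ⟨fun h => ⟨h.2, h.1.card_eq⟩, fun h => ⟨isNClique_of_subset hρ'.isClique h.1 h.2, h.1⟩⟩

theorem vol_mono (G : SimpleGraph V) (d : ℕ) {S C : Finset (Finset V)} (h : S ⊆ C) :
    vol G d S ≤ vol G d C :=
  sum_le_sum_of_subset h

theorem vol_faces_succ_le (G : SimpleGraph V) {d r : ℕ} :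
    vol G d (faces G (r + 1)) ≤ d * vol G d (faces G r) := by
  rw [vol_faces, vol_faces, ← mul_assoc]
  refine Nat.mul_le_mul_right _ ?_
  have h := Nat.choose_succ_right_eq (d + 1) (r + 1)
  calc (d + 1).choose (r + 1 + 1) ≤ (d + 1).choose (r + 1 + 1) * (r + 1 + 1) :=
        Nat.le_mul_of_pos_right _ (by omega)
    _ = (d + 1).choose (r + 1) * (d + 1 - (r + 1)) := h
    _ ≤ (d + 1).choose (r + 1) * d := Nat.mul_le_mul_left _ (by omega)
    _ = d * (d + 1).choose (r + 1) := mul_comm _ _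

theorem vol_faces_succ_pos (G : SimpleGraph V) {d r : ℕ} (hr : r < d)
    (h : 0 < vol G d (faces G r)) : 0 < vol G d (faces G (r + 1)) := by
  rw [vol_faces] at h ⊢
  exact Nat.mul_pos (Nat.choose_pos (by omega)) (Nat.pos_of_mul_pos_left h)

theorem vol_vertices_le (G : SimpleGraph V) {d : ℕ} (hd : 1 ≤ d) :
    vol G d (faces G 0) ≤ 2 * vol G d (faces G 1) := by
  rw [vol_faces, vol_faces, ← mul_assoc]
  refine Nat.mul_le_mul_right _ ?_
  have h := Nat.choose_succ_right_eq (d + 1) 1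
  simp only [Nat.choose_one_right, zero_add, Nat.add_sub_cancel, Nat.reduceAdd] at h ⊢
  nlinarith

theorem le_conductance_of_vol_le (G : SimpleGraph V) {d r B : ℕ} (hr : r < d) (hB : 0 < B)
    {S F : Finset (Finset V)} (hS : S ⊆ faces G r) (hS0 : 0 < vol G d S)
    (h : vol G d S ≤ B * vol G d F) :
    1 / ((d : ℝ) * B) ≤ cochainNorm G d (r + 1) F / cochainNorm G d r S := by
  unfold cochainNorm
  have h0 : 0 < vol G d (faces G r) := hS0.trans_le (vol_mono G d hS)
  have h1 := vol_faces_succ_pos G hr h0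
  have h2 := vol_faces_succ_le G (d := d) (r := r)
  have hd : 0 < d := by omega
  generalize vol G d (faces G r) = v0 at *
  generalize vol G d (faces G (r + 1)) = v1 at *
  generalize vol G d S = a at *
  generalize vol G d F = b at *
  rw [div_div_div_eq, div_le_div_iff₀ (by positivity) (by positivity)]
  have : v1 * a ≤ (d * v0) * (B * b) := Nat.mul_le_mul h2 h
  have h3 : (v1 * a : ℝ) ≤ (d * v0) * (B * b) := by exact_mod_cast this
  linarith

theorem conductance_le_of_vol (G : SimpleGraph V) {d : ℕ} (hd : 1 ≤ d)
    {S F : Finset (Finset V)} :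
    cochainNorm G d 1 F / cochainNorm G d 0 S ≤ 2 * ((vol G d F : ℝ) / vol G d S) := by
  unfold cochainNorm
  have h2 := vol_vertices_le G hd
  generalize vol G d (faces G 0) = v0 at *
  generalize vol G d (faces G 1) = v1 at *
  generalize vol G d S = a at *
  generalize vol G d F = b at *
  rcases Nat.eq_zero_or_pos v1 with h | h
  · subst h
    simp only [CharP.cast_eq_zero, div_zero, zero_div]
    positivity
  have h3 : (v0 : ℝ) / v1 ≤ 2 := by
    rw [div_le_iff₀ (by positivity)]
    exact_mod_cast h2
  calc (b / v1 : ℝ) / (a / v0) = (v0 / v1) * (b / a) := by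
        rw [div_div_eq_mul_div]; ring
    _ ≤ 2 * (b / a) := by gcongr

end Volume

/-! ### Internal conductance of clique complexes covered by cells -/

section Cells

variable {V : Type*}

open Classical in
/-- The Johnson graph is connected: between a set in `S` and one outside of `S` of the same size
there is a pair of neighbors of this kind. -/
theorem exists_exchange (Q : Finset V) (S : Finset (Finset V)) (n : ℕ) :
    ∀ (e : ℕ) (τ τ' : Finset V), (τ' \ τ).card = e → τ ⊆ Q → τ' ⊆ Q → τ.card = n → τ'.card = n →
      τ ∈ S → τ' ∉ S →
      ∃ τ₁ τ₂ : Finset V, τ₁ ∈ S ∧ τ₂ ∉ S ∧ τ₁ ⊆ Q ∧ τ₂ ⊆ Q ∧ τ₁.card = n ∧ τ₂.card = n ∧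
        (τ₁ ∪ τ₂).card = n + 1 := by
  intro e
  induction e with
  | zero =>
    intro τ τ' he _ _ hn hn' hS hS'
    have : τ' ⊆ τ := by simpa using he
    rw [eq_of_subset_of_card_le this (by omega)] at hS'
    exact absurd hS hS'
  | succ e ih =>
    intro τ τ' he hQ hQ' hn hn' hS hS'
    obtain ⟨b, hb⟩ : (τ' \ τ).Nonempty := card_pos.1 (by omega)
    obtain ⟨a, ha⟩ : (τ \ τ').Nonempty := by
      have := card_sdiff_add_card_inter τ τ'
      have h2 := card_sdiff_add_card_inter τ' τ
      rw [inter_comm] at h2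
      exact card_pos.1 (by omega)
    rw [mem_sdiff] at hb ha
    have hcard : (insert b (τ.erase a)).card = n := by
      rw [card_insert_of_notMem (by simp [hb.2]), card_erase_of_mem ha.1]
      have := card_pos.2 ⟨a, ha.1⟩
      omega
    have hsub : insert b (τ.erase a) ⊆ Q :=
      insert_subset (hQ' hb.1) ((erase_subset _ _).trans hQ)
    -- Exchanging `a` for `b` brings `τ` closer to `τ'`. Either the result is still in `S` and the
    -- induction goes on, or this exchange is the required pair.
    by_cases h : insert b (τ.erase a) ∈ S
    · refine ih _ τ' ?_ hsub hQ' hcard hn' h hS'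
      have : τ' \ insert b (τ.erase a) = (τ' \ τ).erase b := by
        ext x
        simp only [mem_sdiff, mem_insert, mem_erase]
        constructor
        · rintro ⟨h1, h2⟩
          refine ⟨fun h => h2 (Or.inl h), h1, fun h => h2 (Or.inr ⟨?_, h⟩)⟩
          rintro rfl
          exact ha.2 h1
        · rintro ⟨h1, h2, h3⟩
          exact ⟨h2, by tauto⟩
      rw [this, card_erase_of_mem (by simp [hb]), he, Nat.add_sub_cancel]
    · refine ⟨τ, _, hS, h, hQ, hsub, hn, hcard, ?_⟩
      have : τ ∪ insert b (τ.erase a) = insert b τ := by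
        ext x
        simp only [mem_union, mem_insert, mem_erase]
        tauto
      rw [this, card_insert_of_notMem hb.2, hn]

/-- A covering of the clique complex of `G` by cliques `Q i`, the cells, up to isolated vertices. -/
structure IsCellCover {I : Type*} (G : SimpleGraph V) (d c : ℕ) (Q : I → Finset V) : Prop where
  isClique : ∀ i, G.IsClique (Q i : Set V)
  lt_card : ∀ i, d < (Q i).card
  card_le : ∀ i, (Q i).card ≤ c
  exists_subset : ∀ σ : Finset V, G.IsClique (σ : Set V) → 2 ≤ σ.card → ∃ i, σ ⊆ Q i
  exists_card_le_two : ∀ v, ∃ T : Finset I, T.card ≤ 2 ∧ ∀ i, v ∈ Q i → i ∈ T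

variable [Fintype V]

open Classical in
theorem IsCellCover.faceDegree_pos {I : Type*} {G : SimpleGraph V} {d c : ℕ} {Q : I → Finset V}
    (h : IsCellCover G d c Q) {σ : Finset V} (hσ : G.IsClique (σ : Set V)) (h2 : 2 ≤ σ.card)
    (hd : σ.card ≤ d + 1) : 0 < faceDegree G d σ := by
  obtain ⟨i, hi⟩ := h.exists_subset σ hσ h2
  obtain ⟨ρ, h1, h3, h4⟩ := exists_subsuperset_card_eq hi hd (h.lt_card i)
  refine card_pos.2 ⟨ρ, ?_⟩
  rw [mem_filter, mem_faces]
  exact ⟨isNClique_of_subset (h.isClique i) h3 h4, h1⟩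

-- The volume counts pairs of a face in `S` and a `d`-face containing it. As `d ≥ 1`, both lie in a
-- common cell, and a cell has at most `2 ^ c * 2 ^ c` pairs of subsets. In particular isolated
-- vertices carry no volume.
open Classical in
theorem IsCellCover.vol_le {I : Type*} [Fintype I] {G : SimpleGraph V} {d c : ℕ}
    {Q : I → Finset V} (h : IsCellCover G d c Q) (hd : 1 ≤ d) (S : Finset (Finset V)) :
    vol G d S ≤ 4 ^ c * (univ.filter fun i => ∃ τ ∈ S, τ ⊆ Q i).card := by
  unfold vol faceDegree
  rw [← card_sigma]
  calc _ ≤ ((univ.filter fun i => ∃ τ ∈ S, τ ⊆ Q i).biUnion fun i =>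
            (((Q i).powerset ×ˢ (Q i).powerset).image
              fun p => (⟨p.1, p.2⟩ : Σ _ : Finset V, Finset V))).card := by
        refine card_le_card fun p hp => ?_
        simp only [mem_sigma, mem_filter, mem_faces] at hp
        obtain ⟨hp1, hp2, hp3⟩ := hp
        obtain ⟨i, hi⟩ := h.exists_subset p.2 hp2.isClique (by rw [hp2.card_eq]; omega)
        simp only [mem_biUnion, mem_filter, mem_univ, true_and, mem_image, mem_product,
          mem_powerset, Prod.exists]
        exact ⟨i, ⟨p.1, hp1, hp3.trans hi⟩, p.1, p.2, ⟨hp3.trans hi, hi⟩, rfl⟩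
    _ ≤ (univ.filter fun i => ∃ τ ∈ S, τ ⊆ Q i).card * 4 ^ c := by
        refine card_biUnion_le_card_mul _ _ _ fun i _ => card_image_le.trans ?_
        rw [card_product, card_powerset, ← mul_pow]
        exact Nat.pow_le_pow_right (by norm_num) (h.card_le i)
    _ = _ := mul_comm _ _

-- Call a cell mixed if it contains `r`-faces both inside and outside of `S`. Two unmixed cells of
-- opposite kinds share no `r`-face, hence fewer than `r + 1 ≤ d` vertices, so `hsep` bounds the
-- smaller unmixed class by the number of mixed cells. Each mixed cell contains a cut face by
-- `exists_exchange`, and volumes are controlled by numbers of cells.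
open Classical in
theorem IsCellCover.internalConductance_ge {I : Type*} [Fintype I] {G : SimpleGraph V}
    {d c C : ℕ} {Q : I → Finset V} (h : IsCellCover G d c Q) (hd : 1 ≤ d)
    (hsep : ∀ A B : Finset I, Disjoint A B → (∀ i ∈ A, ∀ j ∈ B, (Q i ∩ Q j).card < d) →
      min A.card B.card ≤ C * (univ \ (A ∪ B)).card) {r : ℕ} (hr : r < d) :
    ((1 / ((d : ℝ) * (2 * 4 ^ c * (C + 1) : ℕ)) : ℝ) : EReal) ≤
      internalConductance G d r (faces G r) := by
  unfold internalConductance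
  refine le_iInf fun S => le_iInf fun hS => ?_
  obtain ⟨hS1, hS0, hS2⟩ := hS
  rw [EReal.coe_le_coe_iff]
  refine le_conductance_of_vol_le G hr (by positivity) hS1.subset hS0 ?_
  set F := expanderFace G r S (faces G r \ S) with hF
  set inS : Finset I := univ.filter fun i => ∃ τ ∈ S, τ ⊆ Q i with hinS
  set inC : Finset I := univ.filter fun i => ∃ τ ∈ faces G r \ S, τ ⊆ Q i with hinC
  have hcover : ∀ i, i ∈ inS ∨ i ∈ inC := by
    intro i
    obtain ⟨τ, hτ, hτc⟩ := exists_subset_card_eq (s := Q i) (n := r + 1)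
      (by have := h.lt_card i; omega)
    have hτf : τ ∈ faces G r := mem_faces.2 (isNClique_of_subset (h.isClique i) hτ hτc)
    by_cases hτS : τ ∈ S
    · exact Or.inl (by simp only [hinS, mem_filter, mem_univ, true_and]; exact ⟨τ, hτS, hτ⟩)
    · refine Or.inr ?_
      simp only [hinC, mem_filter, mem_univ, true_and, mem_sdiff]
      exact ⟨τ, ⟨hτf, hτS⟩, hτ⟩
  -- The factor 2 appears because a cut face lies only in cells through any fixed one of its
  -- vertices.
  have hmixed : (inS ∩ inC).card ≤ F.card * 2 := by
    have hface : ∀ i ∈ inS ∩ inC, ∃ σ ∈ F, σ ⊆ Q i := by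
      intro i hi
      simp only [hinS, hinC, mem_inter, mem_filter, mem_univ, true_and, mem_sdiff] at hi
      obtain ⟨⟨τ, hτS, hτ⟩, τ', ⟨hτf', hτS'⟩, hτ'⟩ := hi
      have hτf := hS1.subset hτS
      obtain ⟨τ₁, τ₂, h1, h2, h3, h4, h5, h6, h7⟩ := exists_exchange (Q i) S (r + 1) _ τ τ' rfl
        hτ hτ' (mem_faces.1 hτf).card_eq (mem_faces.1 hτf').card_eq hτS hτS'
      refine ⟨τ₁ ∪ τ₂, ?_, union_subset h3 h4⟩
      simp only [hF, expanderFace, mem_filter, mem_faces, mem_sdiff]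
      exact ⟨isNClique_of_subset (h.isClique i) (union_subset h3 h4) h7, τ₁, h1, τ₂,
        ⟨isNClique_of_subset (h.isClique i) h4 h6, h2⟩, subset_union_left, subset_union_right⟩
    choose! f hf hfQ using hface
    refine card_le_mul_card_image_of_maps_to (f := f) hf 2 ?_ |>.trans (by rw [mul_comm])
    intro σ hσ
    have hσ' := (mem_filter.1 hσ).1
    obtain ⟨v, hv⟩ : σ.Nonempty := card_pos.1 (by rw [(mem_faces.1 hσ').card_eq]; omega)
    obtain ⟨T, hT, hvT⟩ := h.exists_card_le_two v
    refine (card_le_card fun l hl => ?_).trans hT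
    rw [mem_filter] at hl
    exact hvT l (hfQ l hl.1 (hl.2 ▸ hv))
  have hFvol : F.card ≤ vol G d F := by
    unfold vol
    rw [card_eq_sum_ones]
    refine sum_le_sum fun σ hσ => ?_
    have hσ' := mem_faces.1 (mem_filter.1 hσ).1
    exact h.faceDegree_pos hσ'.isClique (by rw [hσ'.card_eq]; omega) (by rw [hσ'.card_eq]; omega)
  -- As `S` has at most half of the volume, it does not matter which of the two unmixed classes is
  -- the smaller one.
  have hS3 : vol G d S ≤ vol G d (faces G r \ S) := by
    have : vol G d (faces G r \ S) + vol G d S = vol G d (faces G r) :=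
      sum_sdiff hS1.subset
    omega
  have hv1 : vol G d S ≤ 4 ^ c * inS.card := h.vol_le hd S
  have hv2 : vol G d (faces G r \ S) ≤ 4 ^ c * inC.card := h.vol_le hd _
  have hsep' := hsep (inS \ inC) (inC \ inS) ?_ ?_
  · have hrest : univ \ ((inS \ inC) ∪ (inC \ inS)) = inS ∩ inC := by
      ext i
      have := hcover i
      simp only [mem_sdiff, mem_univ, mem_union, true_and, mem_inter]
      tauto
    rw [hrest] at hsep'
    have e1 := card_sdiff_add_card_inter inS inC
    have e2 := card_sdiff_add_card_inter inC inS
    rw [inter_comm] at e2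
    have hmin : vol G d S ≤ 4 ^ c * ((C + 1) * (inS ∩ inC).card) := by
      rcases min_le_iff.1 hsep' with h' | h'
      · exact hv1.trans (Nat.mul_le_mul_left _ (by rw [add_mul]; omega))
      · exact hS3.trans (hv2.trans (Nat.mul_le_mul_left _ (by rw [add_mul]; omega)))
    calc vol G d S ≤ 4 ^ c * ((C + 1) * (inS ∩ inC).card) := hmin
      _ ≤ 4 ^ c * ((C + 1) * (vol G d F * 2)) := by gcongr; omega
      _ = _ := by ring
  · exact disjoint_sdiff_sdiff
  · intro i hi j hj
    by_contra! hcon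
    obtain ⟨τ, hτ, hτc⟩ := exists_subset_card_eq (s := Q i ∩ Q j) (n := r + 1) (by omega)
    have hτf : τ ∈ faces G r :=
      mem_faces.2 (isNClique_of_subset (h.isClique i) (hτ.trans inter_subset_left) hτc)
    simp only [hinS, hinC, mem_sdiff, mem_filter, mem_univ, true_and, not_exists, not_and] at hi hj
    by_cases hτS : τ ∈ S
    · exact hj.2 τ hτS (hτ.trans inter_subset_right)
    · exact hi.2 τ ⟨hτf, hτS⟩ (hτ.trans inter_subset_left)

end Cells

/-! ### Many large pieces without edges between them imply distance from clusterability -/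

section Far

variable {V : Type*} [Fintype V]

open Classical in
/-- The vertices at which `G` and `H` have different edges. -/
noncomputable def touched (G H : SimpleGraph V) : Finset V :=
  univ.filter fun v => ∃ e ∈ symmDiff G.edgeSet H.edgeSet, v ∈ e

theorem card_touched_le (G H : SimpleGraph V) :
    (touched G H).card ≤ (symmDiff G.edgeSet H.edgeSet).ncard * 2 := by
  classical
  rw [Set.ncard_eq_toFinset_card']
  refine le_trans (card_le_card (t := (symmDiff G.edgeSet H.edgeSet).toFinset.biUnion
    fun e => univ.filter (· ∈ e)) fun v hv => ?_) (card_biUnion_le_card_mul _ _ _ fun e _ => ?_)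
  · simpa only [touched, mem_filter, mem_univ, true_and, mem_biUnion, Set.mem_toFinset] using hv
  · induction e with
    | _ a b =>
      refine (card_le_card (t := {a, b}) fun v hv => ?_).trans card_le_two
      simpa using hv

theorem adj_iff_of_notMem_touched {G H : SimpleGraph V} {u : V} (hu : u ∉ touched G H) (v : V) :
    H.Adj u v ↔ G.Adj u v := by
  classical
  by_contra hcon
  refine hu ?_
  simp only [touched, mem_filter, mem_univ, true_and]
  refine ⟨s(u, v), ?_, Sym2.mem_mk_left u v⟩
  simp only [Set.mem_symmDiff, SimpleGraph.mem_edgeSet]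
  tauto

open Classical in
/-- The vertices of `A`, as `0`-faces. -/
noncomputable def vertexFaces (A : Finset V) : Finset (Finset V) := A.image fun v => {v}

theorem facesIn_zero (H : SimpleGraph V) (A : Finset V) : facesIn H 0 A = vertexFaces A := by
  classical
  ext σ
  simp only [facesIn, vertexFaces, mem_filter, mem_faces, zero_add, mem_image]
  constructor
  · rintro ⟨h1, h2⟩
    obtain ⟨v, rfl⟩ := card_eq_one.1 h1.card_eq
    exact ⟨v, by simpa using h2, rfl⟩
  · rintro ⟨v, hv, rfl⟩
    exact ⟨⟨by simp, by simp⟩, by simpa using hv⟩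

-- The modified graph `H` has no degree bound of its own. At an untouched vertex, however, its
-- neighbors are those in `G`, and every face through the vertex lies in a closed neighborhood of at
-- most `D + 1` vertices.
open Classical in
theorem faceDegree_le {G H : SimpleGraph V} {d D : ℕ}
    (hdeg : ∀ v, (univ.filter fun u => G.Adj v u).card ≤ D) {u : V} (hu : u ∉ touched G H)
    {σ : Finset V} (hσ : u ∈ σ) : faceDegree H d σ ≤ 2 ^ (D + 1) := by
  unfold faceDegree
  refine (card_le_card (t := (insert u (univ.filter fun v => G.Adj u v)).powerset)
    fun ρ hρ => ?_).trans ?_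
  · rw [mem_filter, mem_faces] at hρ
    rw [mem_powerset]
    intro v hv
    rw [mem_insert, mem_filter]
    by_cases h : v = u
    · exact Or.inl h
    · refine Or.inr ⟨mem_univ _, ?_⟩
      rw [← adj_iff_of_notMem_touched hu]
      exact hρ.1.isClique (hρ.2 hσ) hv (Ne.symm h)
  · rw [card_powerset]
    exact Nat.pow_le_pow_right (by norm_num)
      ((card_insert_le _ _).trans (Nat.add_le_add_right (hdeg u) 1))

-- An edge of `H` at an untouched vertex is an edge of `G` and stays inside `K`. If it leaves the
-- set, its other end must be touched, and each touched vertex has at most `D` such edges. Removing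
-- the touched vertices from the set also keeps the degrees of the cut edges bounded.
open Classical in
theorem vol_cut_le {G H : SimpleGraph V} {d D : ℕ}
    (hdeg : ∀ v, (univ.filter fun u => G.Adj v u).card ≤ D) {A K : Finset V}
    (hK : ∀ v ∈ K, ∀ u, G.Adj v u → u ∈ K) :
    vol H d (expanderFace H 0 (vertexFaces ((A ∩ K) \ touched G H))
      (vertexFaces A \ vertexFaces ((A ∩ K) \ touched G H))) ≤
        (touched G H).card * D * 2 ^ (D + 1) := by
  have hmem : ∀ σ ∈ expanderFace H 0 (vertexFaces ((A ∩ K) \ touched G H))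
      (vertexFaces A \ vertexFaces ((A ∩ K) \ touched G H)),
      ∃ v ∈ touched G H, ∃ u, G.Adj v u ∧ u ∉ touched G H ∧ σ = {v, u} := by
    intro σ hσ
    simp only [expanderFace, zero_add, mem_filter, vertexFaces, mem_faces, Nat.reduceAdd, mem_image,
      mem_sdiff, exists_exists_and_eq_and, not_exists, not_and] at hσ
    obtain ⟨hσ1, u, ⟨hu1, hu2⟩, τ, ⟨⟨v, hv, rfl⟩, hv2⟩, h1, h2⟩ := hσ
    rw [singleton_subset_iff] at h1 h2
    have huv : v ≠ u := by
      rintro rfl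
      exact hv2 v ⟨hu1, hu2⟩ rfl
    have hadj : G.Adj u v := by
      rw [← adj_iff_of_notMem_touched hu2]
      exact hσ1.isClique h1 h2 huv.symm
    refine ⟨v, ?_, u, hadj.symm, hu2, ?_⟩
    · by_contra hcon
      exact hv2 v ⟨mem_inter.2 ⟨hv, hK u (mem_inter.1 hu1).2 v hadj⟩, hcon⟩ rfl
    · refine (eq_of_subset_of_card_le (insert_subset h2 (by simpa using h1)) ?_).symm
      rw [hσ1.card_eq, card_pair huv]
  unfold vol
  refine (sum_le_card_nsmul _ _ (2 ^ (D + 1)) fun σ hσ => ?_).trans ?_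
  · obtain ⟨v, _, u, _, hu, rfl⟩ := hmem σ hσ
    exact faceDegree_le hdeg hu (by simp)
  · rw [smul_eq_mul]
    refine Nat.mul_le_mul_right _ ?_
    refine (card_le_card (t := (touched G H).biUnion fun v =>
      (univ.filter fun u => G.Adj v u).image fun u => {v, u}) fun σ hσ => ?_).trans
      (card_biUnion_le_card_mul _ _ _ fun v _ => card_image_le.trans (hdeg v))
    obtain ⟨v, hv, u, h1, _, rfl⟩ := hmem σ hσ
    simp only [mem_biUnion, mem_image, mem_filter, mem_univ, true_and]
    exact ⟨v, hv, u, h1, rfl⟩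

-- A vertex whose closed neighborhood in `G` avoids the touched vertices keeps its `d`-face in `H`
-- and so contributes at least 1 to the volume.
open Classical in
theorem le_vol_vertexFaces {G H : SimpleGraph V} {d D : ℕ}
    (hdeg : ∀ v, (univ.filter fun u => G.Adj v u).card ≤ D) {A K : Finset V}
    (hcell : ∀ v ∈ K, ∃ Q, G.IsNClique (d + 1) Q ∧ v ∈ Q) :
    (A ∩ K).card ≤ vol H d (vertexFaces ((A ∩ K) \ touched G H)) +
      (touched G H).card * (D + 1) := by
  set Z := (touched G H).biUnion fun v => insert v (univ.filter fun u => G.Adj v u) with hZ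
  have hZc : Z.card ≤ (touched G H).card * (D + 1) :=
    card_biUnion_le_card_mul _ _ _ fun v _ =>
      (card_insert_le _ _).trans (Nat.add_le_add_right (hdeg v) 1)
  have hvol : ((A ∩ K) \ Z).card ≤ vol H d (vertexFaces ((A ∩ K) \ touched G H)) := by
    unfold vol vertexFaces
    rw [sum_image (by intro a _ b _ hab; simpa using hab), card_eq_sum_ones]
    refine (sum_le_sum fun v hv => ?_).trans (sum_le_sum_of_subset (sdiff_subset_sdiff le_rfl ?_))
    · obtain ⟨hv1, hv2⟩ := mem_sdiff.1 hv
      obtain ⟨Q, hQ, hvQ⟩ := hcell v (mem_inter.1 hv1).2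
      refine card_pos.2 ⟨Q, ?_⟩
      rw [mem_filter, mem_faces]
      refine ⟨⟨fun a ha b hb hab => ?_, hQ.card_eq⟩, by simpa using hvQ⟩
      refine (adj_iff_of_notMem_touched (fun hat => hv2 ?_) b).2 (hQ.isClique ha hb hab)
      simp only [hZ, mem_biUnion, mem_insert, mem_filter, mem_univ, true_and]
      refine ⟨a, hat, ?_⟩
      by_cases h : v = a
      · exact Or.inl h
      · exact Or.inr (hQ.isClique ha hvQ (Ne.symm h))
    · intro v hv
      simp only [hZ, mem_biUnion, mem_insert]
      exact ⟨v, hv, Or.inl rfl⟩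
  have := card_le_card_sdiff_add_card (s := A ∩ K) (t := Z)
  omega

-- The part `A` contains two disjoint sets, so the one with the smaller volume has at most half of
-- the volume of `A` and is admissible in the minimum. The factor 2 in `hψ` comes from
-- `conductance_le_of_vol`.
open Classical in
theorem internalConductance_lt {G H : SimpleGraph V} {d D : ℕ} (hd : 1 ≤ d)
    (hdeg : ∀ v, (univ.filter fun u => G.Adj v u).card ≤ D) {A K K' : Finset V}
    (hKK' : Disjoint K K') (hK : ∀ v ∈ K, ∀ u, G.Adj v u → u ∈ K)
    (hpos : 0 < vol H d (vertexFaces ((A ∩ K) \ touched G H)))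
    (hle : vol H d (vertexFaces ((A ∩ K) \ touched G H)) ≤
      vol H d (vertexFaces ((A ∩ K') \ touched G H))) {ψ : ℝ}
    (hψ : 2 * (((touched G H).card * D * 2 ^ (D + 1) : ℕ) : ℝ) <
      ψ * vol H d (vertexFaces ((A ∩ K) \ touched G H))) :
    internalConductance H d 0 (facesIn H 0 A) < ψ := by
  rw [facesIn_zero]
  set S := vertexFaces ((A ∩ K) \ touched G H) with hS
  set S' := vertexFaces ((A ∩ K') \ touched G H) with hS'
  have hSA : S ⊆ vertexFaces A := image_subset_image (sdiff_subset.trans inter_subset_left)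
  have hSA' : S' ⊆ vertexFaces A := image_subset_image (sdiff_subset.trans inter_subset_left)
  have hdisj : Disjoint S S' := by
    rw [hS, hS', vertexFaces, vertexFaces, disjoint_image (singleton_injective)]
    exact (hKK'.mono inter_subset_right inter_subset_right).mono sdiff_subset sdiff_subset
  have hne : S'.Nonempty := by
    rw [nonempty_iff_ne_empty]
    intro h0
    rw [h0] at hle
    simp only [vol, sum_empty] at hle hpos
    omega
  have hvol : vol H d S + vol H d S' ≤ vol H d (vertexFaces A) := by
    unfold vol
    rw [← sum_union hdisj]
    exact sum_le_sum_of_subset (union_subset hSA hSA')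
  have hss : S ⊂ vertexFaces A := by
    refine Finset.ssubset_iff_subset_ne.2 ⟨hSA, fun h => ?_⟩
    obtain ⟨x, hx⟩ := hne
    exact (disjoint_right.1 hdisj hx) (h ▸ hSA' hx)
  refine lt_of_le_of_lt (iInf_le_of_le S (iInf_le _ ⟨hss, hpos, by omega⟩)) ?_
  rw [EReal.coe_lt_coe_iff]
  refine lt_of_le_of_lt (conductance_le_of_vol H hd) ?_
  have hpos' : (0 : ℝ) < vol H d S := by exact_mod_cast hpos
  rw [← mul_div_assoc, div_lt_iff₀ hpos']
  refine lt_of_le_of_lt ?_ hψ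
  have := vol_cut_le (H := H) (d := d) hdeg (A := A) hK
  rw [← hS] at this
  gcongr

open Classical in
/-- A graph of bounded degree with `k + 1` large unions of components that are covered by `d`-faces
is far from having a cluster with at most `k` parts. -/
theorem isFar_of_classes [DecidableEq V] {G : SimpleGraph V} {d k dmax D w : ℕ} (hd : 1 ≤ d)
    (hk : 1 ≤ k) (hdeg : ∀ v, (univ.filter fun u => G.Adj v u).card ≤ D)
    (K : Fin (k + 1) → Finset V) (hdisj : Pairwise fun c c' => Disjoint (K c) (K c'))
    (hK : ∀ c, ∀ v ∈ K c, ∀ u, G.Adj v u → u ∈ K c)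
    (hcell : ∀ c, ∀ v ∈ K c, ∃ Q, G.IsNClique (d + 1) Q ∧ v ∈ Q) (hw : ∀ c, w ≤ (K c).card)
    {ψin ψout ε : ℝ} (hψ : 0 < ψin) (hε : 0 ≤ ε)
    (hsmall : 2 * (2 * (ε * dmax * Fintype.card V) * D * 2 ^ (D + 1)) <
      ψin * ((w : ℝ) / k - 2 * (ε * dmax * Fintype.card V) * (D + 1))) :
    IsFar G d k dmax ψin ψout ε := by
  obtain rfl : ‹DecidableEq V› = fun a b => Classical.propDecidable (a = b) := Subsingleton.elim _ _
  rintro H hH ⟨P, -, hPk, hP⟩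
  -- Averaging: one of at most `k` parts holds at least a `1/k` share of the class.
  have hpart : ∀ c, ∃ A ∈ P.parts, w ≤ k * (A ∩ K c).card := by
    intro c
    by_contra! hcon
    have h1 : (K c).card ≤ ∑ A ∈ P.parts, (A ∩ K c).card := by
      refine (card_le_card (t := P.parts.biUnion fun A => A ∩ K c) fun v hv => ?_).trans
        card_biUnion_le
      obtain ⟨A, hA, hvA⟩ := P.exists_mem (mem_univ v)
      simp only [mem_biUnion, mem_inter]
      exact ⟨A, hA, hvA, hv⟩
    have hne : P.parts.Nonempty := by
      rw [nonempty_iff_ne_empty]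
      intro h0
      have hKc := hw c
      have h2 : w ≠ 0 := by
        rintro rfl
        have : (0 : ℝ) ≤ ε * dmax * Fintype.card V := by positivity
        have h3 : 0 ≤ 2 * (2 * (ε * dmax * Fintype.card V) * D * 2 ^ (D + 1)) := by positivity
        have h4 : ψin * (((0 : ℕ) : ℝ) / k - 2 * (ε * dmax * Fintype.card V) * (D + 1)) ≤ 0 :=
          mul_nonpos_of_nonneg_of_nonpos hψ.le (by
            simp only [CharP.cast_eq_zero, zero_div, zero_sub, Left.neg_nonpos_iff]; positivity)
        linarith
      rw [h0, sum_empty] at h1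
      omega
    have h2 : ∑ A ∈ P.parts, k * (A ∩ K c).card < ∑ _A ∈ P.parts, w :=
      sum_lt_sum_of_nonempty hne hcon
    rw [← mul_sum, sum_const, smul_eq_mul] at h2
    have h3 : k * w ≤ k * ∑ A ∈ P.parts, (A ∩ K c).card :=
      Nat.mul_le_mul_left _ ((hw c).trans h1)
    have h4 : P.parts.card * w ≤ k * w := Nat.mul_le_mul_right _ hPk
    omega
  choose f hfP hfw using hpart
  -- By the pigeonhole principle, two of the `k + 1` classes have large shares in the same part.
  obtain ⟨c, -, c', -, hcc, hf⟩ := exists_ne_map_eq_of_card_lt_of_maps_to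
    (s := (univ : Finset (Fin (k + 1)))) (t := P.parts) (f := f)
    (by rw [card_univ, Fintype.card_fin]; omega) (fun c _ => hfP c)
  set B := touched G H with hB
  have hBc : (B.card : ℝ) ≤ 2 * (ε * dmax * Fintype.card V) := by
    have : (B.card : ℝ) ≤ (symmDiff G.edgeSet H.edgeSet).ncard * 2 := by
      exact_mod_cast card_touched_le G H
    linarith
  have hvol : ∀ c, 2 * ((B.card * D * 2 ^ (D + 1) : ℕ) : ℝ) <
      ψin * vol H d (vertexFaces ((f c ∩ K c) \ B)) := by
    intro c
    have h1 := le_vol_vertexFaces (H := H) hdeg (A := f c) (hcell c)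
    have h2 : ((f c ∩ K c).card : ℝ) ≤ vol H d (vertexFaces ((f c ∩ K c) \ B)) +
      B.card * (D + 1) := by exact_mod_cast h1
    have h3 : (w : ℝ) / k ≤ (f c ∩ K c).card := by
      rw [div_le_iff₀ (by exact_mod_cast hk), mul_comm]
      exact_mod_cast hfw c
    have h4 : (B.card : ℝ) * (D + 1) ≤ 2 * (ε * dmax * Fintype.card V) * (D + 1) := by gcongr
    calc 2 * ((B.card * D * 2 ^ (D + 1) : ℕ) : ℝ) = 2 * (B.card * D * 2 ^ (D + 1)) := by push_cast; rfl
      _ ≤ 2 * (2 * (ε * dmax * Fintype.card V) * D * 2 ^ (D + 1)) := by gcongr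
      _ < _ := hsmall
      _ ≤ _ := by gcongr; linarith
  have hpos : ∀ c, 0 < vol H d (vertexFaces ((f c ∩ K c) \ B)) := by
    intro c
    by_contra! h
    have h1 := hvol c
    rw [Nat.le_zero.1 h] at h1
    have : (0 : ℝ) ≤ 2 * ((B.card * D * 2 ^ (D + 1) : ℕ) : ℝ) := by positivity
    simp only [CharP.cast_eq_zero, mul_zero] at h1
    linarith
  rcases le_total (vol H d (vertexFaces ((f c ∩ K c) \ B)))
    (vol H d (vertexFaces ((f c ∩ K c') \ B))) with h | h
  · exact absurd (hP _ (hfP c) 0 (by omega)).1 (not_le.2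
      (internalConductance_lt hd hdeg (hdisj hcc) (hK c) (hpos c) h (hvol c)))
  · have hp := hpos c'
    have hv := hvol c'
    rw [← hf] at hp hv
    exact absurd (hP _ (hfP c) 0 (by omega)).1 (not_le.2
      (internalConductance_lt hd hdeg (hdisj hcc.symm) (hK c') hp h hv))

end Far

/-! ### Counting permutations with prescribed values, with and without hidden colors -/

section Counting

variable {X ι κ : Type*} [DecidableEq X] [DecidableEq ι]

/-- The permutations `π b` map `x` to `y` for all `(b, x, y) ∈ R`. -/
def Extends (R : Finset (ι × X × X)) (π : ι → Equiv.Perm X) : Prop :=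
  ∀ p ∈ R, π p.1 p.2.1 = p.2.2

/-- The permutations `π b` map points of a color in `gL` to points of the same color in `gR`. -/
def Respects (gL gR : X → κ) (π : ι → Equiv.Perm X) : Prop :=
  ∀ b x, gR (π b x) = gL x

theorem Extends.of_insert {R : Finset (ι × X × X)} {p : ι × X × X} {π : ι → Equiv.Perm X}
    (h : Extends (insert p R) π) : Extends R π :=
  fun r hr => h r (mem_insert_of_mem hr)

/-- Post-compose the `b`-th permutation by a transposition. -/
def swapAt (π : ι → Equiv.Perm X) (b : ι) (y z : X) : ι → Equiv.Perm X :=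
  Function.update π b (Equiv.swap y z * π b)

theorem swapAt_swapAt (π : ι → Equiv.Perm X) (b : ι) (y z : X) :
    swapAt (swapAt π b y z) b y z = π := by
  simp [swapAt, ← mul_assoc]

theorem swapAt_same (π : ι → Equiv.Perm X) (b : ι) (y z x : X) :
    swapAt π b y z b x = Equiv.swap y z (π b x) := by
  simp [swapAt]

theorem swapAt_of_ne (π : ι → Equiv.Perm X) {b b' : ι} (h : b' ≠ b) (y z : X) :
    swapAt π b y z b' = π b' := by
  simp [swapAt, h]

variable [Fintype X] [Fintype ι]

-- Switching: from `π b x = y`, transposing `y` with any `z` that `R` does not record as a value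
-- keeps `R` satisfied. The new image of `x` is `z`, so the switch can be undone.
open Classical in
theorem card_extends_insert_mul_le {R : Finset (ι × X × X)} {p : ι × X × X} (hp : p ∉ R) :
    (univ.filter fun π : ι → Equiv.Perm X => Extends (insert p R) π).card *
      (Fintype.card X - R.card) ≤ (univ.filter fun π : ι → Equiv.Perm X => Extends R π).card := by
  obtain ⟨b, x, y⟩ := p
  set Z : Finset X := univ \ R.image fun r => r.2.2 with hZ
  have hZc : Fintype.card X - R.card ≤ Z.card := by
    rw [hZ, card_sdiff_of_subset (subset_univ _), card_univ]
    exact Nat.sub_le_sub_left card_image_le _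
  refine (Nat.mul_le_mul_left _ hZc).trans ?_
  rw [← card_product]
  refine card_le_card_of_injOn (fun q => swapAt q.1 b y q.2) ?_ ?_
  · rintro ⟨π, z⟩ hq
    simp only [coe_product, Set.mem_prod, mem_coe, mem_filter, mem_univ, true_and] at hq
    obtain ⟨hπ, hz⟩ := hq
    simp only [coe_filter, mem_univ, true_and, Set.mem_ofPred_eq]
    rintro ⟨b', x', y'⟩ hr
    have h1 : π b' x' = y' := hπ.of_insert _ hr
    have h2 : π b x = y := hπ _ (mem_insert_self _ _)
    by_cases hb : b' = b
    · subst hb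
      simp only [swapAt_same]
      rw [h1, Equiv.swap_apply_of_ne_of_ne]
      · rintro rfl
        rw [← h2] at h1
        rw [(π b').injective h1] at hr
        exact hp hr
      · rintro rfl
        exact (mem_sdiff.1 hz).2 (mem_image_of_mem _ hr)
    · simp only [swapAt_of_ne π hb]
      exact h1
  · rintro ⟨π, z⟩ hq ⟨π', z'⟩ hq' heq
    simp only [coe_product, Set.mem_prod, mem_coe, mem_filter, mem_univ, true_and] at hq hq' heq
    have h2 : π b x = y := hq.1 _ (mem_insert_self _ _)
    have h2' : π' b x = y := hq'.1 _ (mem_insert_self _ _)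
    have h3 := congrArg (fun f => f b x) heq
    simp only [swapAt_same, h2, h2', Equiv.swap_apply_left] at h3
    subst h3
    have h4 := congrArg (fun f => swapAt f b y z) heq
    simp only [swapAt_swapAt] at h4
    rw [h4]

open Classical in
theorem card_extends_mul_le (R : Finset (ι × X × X)) {q : ℕ} (hR : R.card ≤ q) :
    (univ.filter fun π : ι → Equiv.Perm X => Extends R π).card *
      (Fintype.card X - q) ^ R.card ≤ Fintype.card (ι → Equiv.Perm X) := by
  induction R using Finset.induction_on with
  | empty =>
    rw [card_empty, pow_zero, mul_one]
    exact card_le_univ _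
  | insert p R hp ih =>
    rw [card_insert_of_notMem hp] at hR ⊢
    calc _ = (univ.filter fun π : ι → Equiv.Perm X => Extends (insert p R) π).card *
          (Fintype.card X - q) * (Fintype.card X - q) ^ R.card := by rw [pow_succ]; ring
      _ ≤ (univ.filter fun π : ι → Equiv.Perm X => Extends (insert p R) π).card *
          (Fintype.card X - R.card) * (Fintype.card X - q) ^ R.card := by gcongr; omega
      _ ≤ (univ.filter fun π : ι → Equiv.Perm X => Extends R π).card *
          (Fintype.card X - q) ^ R.card := by
        gcongr; exact card_extends_insert_mul_le hp
      _ ≤ _ := ih (by omega)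

-- Switching the value at `x` to `y` exchanges two points of the same color, so the coloring stays
-- respected. The former value at `x` undoes the switch and has at most `M` possibilities. The
-- permutations `π₀` need not respect colors; they only show that the new triple does not collide
-- with `R`.
open Classical in
theorem card_respects_le_mul_insert {gL gR : X → κ} {M : ℕ}
    (hM : ∀ c, (univ.filter fun z => gR z = c).card ≤ M)
    {R : Finset (ι × X × X)} {p : ι × X × X} (hp : p ∉ R) {π₀ : ι → Equiv.Perm X}
    (hπ₀ : Extends (insert p R) π₀) (hcol : gR p.2.2 = gL p.2.1) :
    (univ.filter fun π : ι → Equiv.Perm X => Respects gL gR π ∧ Extends R π).card ≤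
      (univ.filter fun π : ι → Equiv.Perm X =>
        Respects gL gR π ∧ Extends (insert p R) π).card * M := by
  obtain ⟨b, x, y⟩ := p
  simp only at hcol
  refine le_trans ?_ (Nat.mul_le_mul_left _ (hM (gL x)))
  rw [← card_product]
  refine card_le_card_of_injOn (fun π => (swapAt π b (π b x) y, π b x)) ?_ ?_
  · intro π hπ
    simp only [coe_filter, mem_univ, true_and, Set.mem_ofPred_eq] at hπ
    obtain ⟨hres, hext⟩ := hπ
    simp only [coe_product, coe_filter, Set.mem_prod, mem_univ, true_and, Set.mem_ofPred_eq]
    refine ⟨⟨fun b' x' => ?_, fun r hr => ?_⟩, hres b x⟩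
    · by_cases hb : b' = b
      · subst hb
        rw [swapAt_same, ← hres b' x', Equiv.swap_apply_def]
        split_ifs with h1 h2
        · rw [h1, hcol, hres]
        · rw [h2, hcol, hres]
        · rfl
      · rw [swapAt_of_ne π hb, hres]
    · rcases mem_insert.1 hr with rfl | hrR
      · simp [swapAt_same]
      · obtain ⟨b', x', y'⟩ := r
        have h1 : π b' x' = y' := hext _ hrR
        have h2 : π₀ b' x' = y' := hπ₀.of_insert _ hrR
        have h3 : π₀ b x = y := hπ₀ _ (mem_insert_self _ _)
        by_cases hb : b' = b
        · subst hb
          have hx : x' ≠ x := by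
            rintro rfl
            rw [← h2, h3] at hrR
            exact hp hrR
          simp only [swapAt_same]
          rw [Equiv.swap_apply_of_ne_of_ne, h1]
          · exact fun h => hx ((π b').injective h)
          · rw [h1, ← h2, ← h3]
            exact fun h => hx ((π₀ b').injective h)
        · simp only [swapAt_of_ne π hb]
          exact h1
  · intro π _ π' _ heq
    simp only [Prod.mk.injEq] at heq
    have h4 := congrArg (fun f => swapAt f b (π b x) y) heq.1
    simp only [swapAt_swapAt] at h4
    rw [heq.2, swapAt_swapAt] at h4
    exact h4

open Classical in
theorem card_respects_le_mul {gL gR : X → κ} {M : ℕ}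
    (hM : ∀ c, (univ.filter fun z => gR z = c).card ≤ M)
    (R : Finset (ι × X × X)) {π₀ : ι → Equiv.Perm X}
    (hπ₀ : Extends R π₀) (hcol : ∀ p ∈ R, gR p.2.2 = gL p.2.1) :
    (univ.filter fun π : ι → Equiv.Perm X => Respects gL gR π).card ≤
      (univ.filter fun π : ι → Equiv.Perm X =>
        Respects gL gR π ∧ Extends R π).card * M ^ R.card := by
  induction R using Finset.induction_on with
  | empty => simp [Extends]
  | insert p R hp ih =>
    rw [card_insert_of_notMem hp, pow_succ', ← mul_assoc]
    exact (ih hπ₀.of_insert fun r hr => hcol r (mem_insert_of_mem hr)).trans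
      (Nat.mul_le_mul_right _
        (card_respects_le_mul_insert hM hp hπ₀ (hcol p (mem_insert_self _ _))))

open Classical in
theorem card_respects_comp (f : X → κ) (τL τR : Equiv.Perm X) :
    (univ.filter fun π : ι → Equiv.Perm X => Respects (f ∘ τL) (f ∘ τR) π).card =
      (univ.filter fun π : ι → Equiv.Perm X => Respects f f π).card := by
  refine card_bij' (fun π _ b => τR * π b * τL⁻¹) (fun π _ b => τR⁻¹ * π b * τL) ?_ ?_ ?_ ?_
  · intro π hπ
    simp only [mem_filter, mem_univ, true_and] at hπ ⊢
    intro b x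
    simpa using hπ b (τL⁻¹ x)
  · intro π hπ
    simp only [mem_filter, mem_univ, true_and] at hπ ⊢
    intro b x
    simpa using hπ b (τL x)
  · intro π _
    funext b
    simp [mul_assoc]
  · intro π _
    funext b
    simp [mul_assoc]

-- Precomposing `τ` with the transposition of `x` and a point `z ∉ T` of the desired color gives `x`
-- this color and leaves `T` alone. The result together with `z` determines `τ`.
open Classical in
theorem card_colored_le_mul_insert {f : X → κ} {M : ℕ}
    (hM : ∀ c, M ≤ (univ.filter fun z => f z = c).card) (T : Finset X) (g : X → κ) {x : X}
    (hx : x ∉ T) :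
    (univ.filter fun τ : Equiv.Perm X => ∀ u ∈ T, f (τ u) = g u).card * (M - T.card) ≤
      (univ.filter fun τ : Equiv.Perm X => ∀ u ∈ insert x T, f (τ u) = g u).card *
        Fintype.card X := by
  set N := univ.filter fun τ : Equiv.Perm X => ∀ u ∈ T, f (τ u) = g u with hN
  calc N.card * (M - T.card)
      ≤ ∑ τ ∈ N, ((univ.filter fun z => f (τ z) = g x) \ T).card := by
        rw [← smul_eq_mul, ← sum_const]
        refine sum_le_sum fun τ _ => ?_
        have h1 : (univ.filter fun z => f (τ z) = g x).card =
            (univ.filter fun z => f z = g x).card :=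
          card_equiv τ (by simp)
        have h2 := le_card_sdiff T (univ.filter fun z => f (τ z) = g x)
        have h3 := hM (g x)
        omega
    _ = (N.sigma fun τ => (univ.filter fun z => f (τ z) = g x) \ T).card := (card_sigma _ _).symm
    _ ≤ _ := by
        rw [← card_univ, ← card_product]
        refine card_le_card_of_injOn (fun q => (q.1 * Equiv.swap x q.2, q.2)) ?_ ?_
        · rintro ⟨τ, z⟩ hq
          simp only [coe_sigma, Set.mem_sigma_iff, mem_coe, mem_sdiff, mem_filter, mem_univ,
            true_and, hN] at hq
          obtain ⟨h1, h2, h3⟩ := hq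
          simp only [coe_product, coe_filter, Set.mem_prod, mem_univ, true_and, Set.mem_ofPred_eq,
            mem_coe, and_true]
          intro u hu
          rcases mem_insert.1 hu with rfl | huT
          · simpa using h2
          · rw [Equiv.Perm.mul_apply, Equiv.swap_apply_of_ne_of_ne, h1 u huT]
            · rintro rfl
              exact hx huT
            · rintro rfl
              exact h3 huT
        · rintro ⟨τ, z⟩ _ ⟨τ', z'⟩ _ heq
          simp only [Prod.mk.injEq] at heq
          obtain ⟨h1, rfl⟩ := heq
          rw [mul_left_injective _ h1]

open Classical in
theorem card_colored_le_mul {f : X → κ} {M q : ℕ}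
    (hM : ∀ c, M ≤ (univ.filter fun z => f z = c).card) (T : Finset X) (hT : T.card ≤ q)
    (g : X → κ) :
    Fintype.card (Equiv.Perm X) * (M - q) ^ T.card ≤
      (univ.filter fun τ : Equiv.Perm X => ∀ u ∈ T, f (τ u) = g u).card *
        Fintype.card X ^ T.card := by
  induction T using Finset.induction_on with
  | empty => simp
  | insert x T hx ih =>
    rw [card_insert_of_notMem hx] at hT ⊢
    have h1 := ih (by omega)
    have h2 := card_colored_le_mul_insert hM T g hx
    calc _ = Fintype.card (Equiv.Perm X) * (M - q) ^ T.card * (M - q) := by ring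
      _ ≤ (univ.filter fun τ : Equiv.Perm X => ∀ u ∈ T, f (τ u) = g u).card *
        Fintype.card X ^ T.card * (M - T.card) := by gcongr; omega
      _ = (univ.filter fun τ : Equiv.Perm X => ∀ u ∈ T, f (τ u) = g u).card * (M - T.card) *
        Fintype.card X ^ T.card := by ring
      _ ≤ _ := by
        rw [pow_succ', ← mul_assoc]
        gcongr

theorem card_le_card_ker_mul {A B : Type*} [AddCommGroup A] [AddCommGroup B] [Finite A] [Finite B]
    (φ : A →+ B) : Nat.card A ≤ Nat.card φ.ker * Nat.card B := by
  rw [← φ.ker.card_mul_index, AddSubgroup.index_ker]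
  exact Nat.mul_le_mul_left _ (Nat.card_le_card_of_injective _ Subtype.val_injective)

open Classical in
/-- A positive proportion of the pairs of relabelings respects the color constraints in `R`. -/
theorem card_consistent_mul_ge [AddCommGroup κ] [Fintype κ] {f : X → κ} {M q : ℕ}
    (hM : ∀ c, M ≤ (univ.filter fun z => f z = c).card) (R : Finset (ι × X × X))
    (hR : R.card ≤ q) :
    Fintype.card κ ^ ((R.image fun p => p.2.1).card + (R.image fun p => p.2.2).card) *
      (Fintype.card (Equiv.Perm X) ^ 2 *
        (M - q) ^ ((R.image fun p => p.2.1).card + (R.image fun p => p.2.2).card)) ≤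
      (univ.filter fun τ : Equiv.Perm X × Equiv.Perm X =>
        ∀ p ∈ R, f (τ.2 p.2.2) = f (τ.1 p.2.1)).card *
      Fintype.card X ^ ((R.image fun p => p.2.1).card + (R.image fun p => p.2.2).card) *
      Fintype.card κ ^ R.card := by
  set TL := R.image fun p => p.2.1 with hTL
  set TR := R.image fun p => p.2.2 with hTR
  have hmL : ∀ p : R, p.1.2.1 ∈ TL := fun p => mem_image_of_mem (fun p => p.2.1) p.2
  have hmR : ∀ p : R, p.1.2.2 ∈ TR := fun p => mem_image_of_mem (fun p => p.2.2) p.2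
  -- The recorded triples demand equal colors at their ends, which is the vanishing of this
  -- homomorphism. Its kernel has at least `|κ| ^ (|TL| + |TR| - |R|)` elements, even if the
  -- recorded edges contain cycles. The group structure on the colors serves only this count.
  let φ : (TL → κ) × (TR → κ) →+ (R → κ) :=
    { toFun := fun g p => g.2 ⟨_, hmR p⟩ - g.1 ⟨_, hmL p⟩
      map_zero' := by funext p; simp
      map_add' := fun g g' => by
        funext p
        simp only [Prod.snd_add, Pi.add_apply, Prod.fst_add]
        abel }
  have hker := card_le_card_ker_mul φ
  simp only [Nat.card_eq_fintype_card, Fintype.card_prod, Fintype.card_fun, Fintype.card_coe]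
    at hker
  rw [← pow_add] at hker
  -- The value `0` outside of `T` is never used.
  let ext (T : Finset X) (g : T → κ) (x : X) : κ := if h : x ∈ T then g ⟨x, h⟩ else 0
  let colL (g : TL → κ) := univ.filter fun τ : Equiv.Perm X => ∀ u ∈ TL, f (τ u) = ext TL g u
  let colR (g : TR → κ) := univ.filter fun τ : Equiv.Perm X => ∀ u ∈ TR, f (τ u) = ext TR g u
  have hcol : ∀ g : φ.ker, Fintype.card (Equiv.Perm X) ^ 2 * (M - q) ^ (TL.card + TR.card) ≤
      (colL g.1.1 ×ˢ colR g.1.2).card * Fintype.card X ^ (TL.card + TR.card) := by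
    intro g
    have h1 := card_colored_le_mul hM TL (card_image_le.trans hR) (ext TL g.1.1)
    have h2 := card_colored_le_mul hM TR (card_image_le.trans hR) (ext TR g.1.2)
    rw [card_product]
    calc _ = (Fintype.card (Equiv.Perm X) * (M - q) ^ TL.card) *
          (Fintype.card (Equiv.Perm X) * (M - q) ^ TR.card) := by ring
      _ ≤ _ := Nat.mul_le_mul h1 h2
      _ = _ := by rw [pow_add]; ring
  have hsum : ∑ g : φ.ker, (colL g.1.1 ×ˢ colR g.1.2).card ≤
      (univ.filter fun τ : Equiv.Perm X × Equiv.Perm X =>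
        ∀ p ∈ R, f (τ.2 p.2.2) = f (τ.1 p.2.1)).card := by
    rw [← card_biUnion]
    · refine card_le_card fun τ hτ => ?_
      simp only [mem_biUnion, mem_univ, true_and, mem_product, mem_filter, colL, colR] at hτ ⊢
      obtain ⟨⟨g, hg⟩, h1, h2⟩ := hτ
      intro p hp
      have h3 := congrFun ((AddMonoidHom.mem_ker).1 hg) ⟨p, hp⟩
      rw [h1 _ (hmL ⟨p, hp⟩), h2 _ (hmR ⟨p, hp⟩)]
      simp only [ext, hmL ⟨p, hp⟩, hmR ⟨p, hp⟩, dif_pos]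
      exact sub_eq_zero.1 h3
    · intro g _ g' _ hgg
      refine disjoint_left.2 fun τ hτ hτ' => ?_
      simp only [mem_product, mem_filter, colL, colR, mem_univ, true_and] at hτ hτ'
      refine hgg (Subtype.ext (Prod.ext (funext fun u => ?_) (funext fun u => ?_)))
      · have h3 := (hτ.1 u u.2).symm.trans (hτ'.1 u u.2)
        simpa [ext] using h3
      · have h3 := (hτ.2 u u.2).symm.trans (hτ'.2 u u.2)
        simpa [ext] using h3
  calc _ ≤ Fintype.card φ.ker * Fintype.card κ ^ R.card *
        (Fintype.card (Equiv.Perm X) ^ 2 * (M - q) ^ (TL.card + TR.card)) := by gcongr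
    _ = Fintype.card κ ^ R.card * ∑ g : φ.ker,
        (Fintype.card (Equiv.Perm X) ^ 2 * (M - q) ^ (TL.card + TR.card)) := by
      rw [sum_const, card_univ, smul_eq_mul]; ring
    _ ≤ Fintype.card κ ^ R.card * ∑ g : φ.ker,
        (colL g.1.1 ×ˢ colR g.1.2).card * Fintype.card X ^ (TL.card + TR.card) := by
      exact Nat.mul_le_mul_left _ (sum_le_sum fun g _ => hcol g)
    _ ≤ Fintype.card κ ^ R.card * ((univ.filter fun τ : Equiv.Perm X × Equiv.Perm X =>
        ∀ p ∈ R, f (τ.2 p.2.2) = f (τ.1 p.2.1)).card *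
          Fintype.card X ^ (TL.card + TR.card)) := by
      rw [← sum_mul]; gcongr
    _ = _ := by ring

open Classical in
/-- Hidden colorings of two copies of `X` together with permutations that respect them. -/
noncomputable def coloredPerms (ι : Type*) [Fintype ι] [DecidableEq ι] (f : X → κ) :
    Finset ((Equiv.Perm X × Equiv.Perm X) × (ι → Equiv.Perm X)) :=
  univ.filter fun ω => Respects (f ∘ ω.1.1) (f ∘ ω.1.2) ω.2

open Classical in
theorem card_coloredPerms (f : X → κ) :
    (coloredPerms ι f).card = Fintype.card (Equiv.Perm X) ^ 2 *
      (univ.filter fun π : ι → Equiv.Perm X => Respects f f π).card := by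
  rw [coloredPerms, ← univ_product_univ, card_filter, sum_product]
  simp only [← card_filter, card_respects_comp, sum_const, card_univ, Fintype.card_prod,
    smul_eq_mul, sq]

-- Write `K` for the number of colors, `r = |R|`, and `e ≤ 2 * q` for the number of points in `R`.
-- Uniform permutations extend `R` with probability at most `(K * M - q) ^ (-r)`. In the colored
-- model the colors fit with probability at least `K ^ (-r) * (1 - q / M) ^ e`, and the values then
-- occur with probability at least `M ^ (-r)`. The ratio is at most `(1 - q / M) ^ (-3 * q)`, which
-- Bernoulli's inequality bounds by `4/3` when `12 * q ^ 2 ≤ M`. This is the source of the square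
-- root.
open Classical in
theorem card_extends_le_coloredPerms [AddCommGroup κ] [Fintype κ] {f : X → κ} {M q : ℕ}
    (hM : ∀ c, (univ.filter fun z => f z = c).card = M) (R : Finset (ι × X × X))
    (hR : R.card ≤ q) (hq : 12 * q ^ 2 ≤ M) (hM0 : 0 < M) :
    3 * ((univ.filter fun π : ι → Equiv.Perm X => Extends R π).card * (coloredPerms ι f).card) ≤
      4 * (((coloredPerms ι f).filter fun ω => Extends R ω.2).card *
        Fintype.card (ι → Equiv.Perm X)) := by
  rcases eq_or_ne (univ.filter fun π : ι → Equiv.Perm X => Extends R π) ∅ with h0 | h0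
  · rw [h0]; simp
  obtain ⟨π₀, hπ₀⟩ := nonempty_iff_ne_empty.2 h0
  rw [mem_filter] at hπ₀
  have hyes := card_extends_mul_le R hR
  set e := (R.image fun p => p.2.1).card + (R.image fun p => p.2.2).card with he
  have he2 : e ≤ 2 * q := by
    have h1 : (R.image fun p => p.2.1).card ≤ R.card := card_image_le
    have h2 : (R.image fun p => p.2.2).card ≤ R.card := card_image_le
    omega
  have hcons := card_consistent_mul_ge (fun c => (hM c).ge) R hR
  rw [← he] at hcons
  set cons := (univ.filter fun τ : Equiv.Perm X × Equiv.Perm X =>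
        ∀ p ∈ R, f (τ.2 p.2.2) = f (τ.1 p.2.1)) with hconsdef
  set h := (univ.filter fun π : ι → Equiv.Perm X => Respects f f π).card with hh
  have hX : Fintype.card X = Fintype.card κ * M := by
    rw [← card_univ, card_eq_sum_card_fiberwise (f := f) (t := univ) (fun _ _ => mem_univ _)]
    simp [hM]
  have hno : cons.card * h ≤ ((coloredPerms ι f).filter fun ω => Extends R ω.2).card *
      M ^ R.card := by
    have : ((coloredPerms ι f).filter fun ω => Extends R ω.2).card =
        ∑ τ : Equiv.Perm X × Equiv.Perm X, (univ.filter fun π : ι → Equiv.Perm X =>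
          Respects (f ∘ τ.1) (f ∘ τ.2) π ∧ Extends R π).card := by
      rw [coloredPerms, filter_filter, ← univ_product_univ, card_filter, sum_product]
      simp only [← card_filter]
    rw [this, sum_mul, ← smul_eq_mul, ← sum_const]
    refine (sum_le_sum fun τ hτ => ?_).trans (sum_le_sum_of_subset (subset_univ cons))
    rw [hh, ← card_respects_comp f τ.1 τ.2]
    refine card_respects_le_mul (fun c => ?_) R hπ₀.2 (mem_filter.1 hτ).2
    rw [← hM c]
    exact (card_equiv τ.2 (by simp)).le
  have hκ : 0 < Fintype.card κ := Fintype.card_pos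
  have hΩ : (coloredPerms ι f).card = Fintype.card (Equiv.Perm X) ^ 2 * h := card_coloredPerms f
  generalize (coloredPerms ι f).card = Ωn at *
  generalize ((coloredPerms ι f).filter fun ω => Extends R ω.2).card = Nn at *
  generalize (univ.filter fun π : ι → Equiv.Perm X => Extends R π).card = Ny at *
  generalize Fintype.card (ι → Equiv.Perm X) = Ωy at *
  generalize Fintype.card (Equiv.Perm X) = P at *
  generalize cons.card = cc at *
  generalize Fintype.card X = m at *
  generalize Fintype.card κ = K at *
  generalize hr : R.card = r at *
  clear_value e h
  subst hX hΩ
  -- `Nn * m ^ r * M ^ e ≥ (M - q) ^ e * Ωn`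
  have h1 : (M - q) ^ e * (P ^ 2 * h) ≤ Nn * (K * M) ^ r * M ^ e := by
    have hKe : 0 < K ^ e := by positivity
    refine Nat.le_of_mul_le_mul_left ?_ hKe
    calc K ^ e * ((M - q) ^ e * (P ^ 2 * h)) = K ^ e * (P ^ 2 * (M - q) ^ e) * h := by ring
      _ ≤ cc * (K * M) ^ e * K ^ r * h := by gcongr
      _ = cc * h * ((K * M) ^ e * K ^ r) := by ring
      _ ≤ Nn * M ^ r * ((K * M) ^ e * K ^ r) := by gcongr
      _ = _ := by rw [mul_pow, mul_pow]; ring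
  have hqM : q ≤ M := by nlinarith
  have hKM : M ≤ K * M := Nat.le_mul_of_pos_left _ hκ
  have hfac : 3 * (M ^ e * (K * M) ^ r) ≤ 4 * ((M - q) ^ e * (K * M - q) ^ r) := by
    have hMr : (0 : ℝ) < M := by exact_mod_cast hM0
    have hKr : (1 : ℝ) ≤ K := by exact_mod_cast hκ
    have hx1 : (q : ℝ) / M ≤ 1 := by rw [div_le_one hMr]; exact_mod_cast hqM
    have hx0 : (0 : ℝ) ≤ q / M := by positivity
    have hb := one_add_mul_le_pow (a := -((q : ℝ) / M)) (by linarith) (3 * q)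
    have hb2 : (3 : ℝ) / 4 ≤ (1 - q / M) ^ (3 * q) := by
      have h3 : (12 * q ^ 2 : ℝ) ≤ M := by exact_mod_cast hq
      have h4 : (3 * q : ℝ) * (q / M) ≤ 1 / 4 := by
        rw [← mul_div_assoc, div_le_iff₀ hMr]; linarith
      rw [← sub_eq_add_neg] at hb
      push_cast at hb
      linarith
    have hb3 : (1 - (q : ℝ) / M) ^ (3 * q) ≤ (1 - q / M) ^ e * (1 - q / M) ^ r := by
      rw [← pow_add]
      exact pow_le_pow_of_le_one (by linarith) (by linarith) (by omega)
    have e1 : (1 - (q : ℝ) / M) * M = ((M - q : ℕ) : ℝ) := by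
      rw [Nat.cast_sub hqM]; field_simp
    have e2 : (1 - (q : ℝ) / M) * (K * M) ≤ ((K * M - q : ℕ) : ℝ) := by
      rw [Nat.cast_sub (hqM.trans hKM)]
      have : (1 - (q : ℝ) / M) * (K * M) = K * M - K * q := by field_simp
      rw [this]
      push_cast
      nlinarith [(Nat.cast_nonneg q : (0 : ℝ) ≤ q)]
    have : (3 : ℝ) * (M ^ e * (K * M) ^ r) ≤ 4 * (((M - q : ℕ) : ℝ) ^ e * ((K * M - q : ℕ) : ℝ) ^ r) := by
      calc (3 : ℝ) * (M ^ e * (K * M) ^ r) = 4 * (3 / 4 * (M ^ e * (K * M) ^ r)) := by ring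
        _ ≤ 4 * (((1 - q / M) ^ e * (1 - q / M) ^ r) * (M ^ e * (K * M) ^ r)) := by
          gcongr; exact hb2.trans hb3
        _ = 4 * (((1 - q / M) * M) ^ e * ((1 - q / M) * (K * M)) ^ r) := by
          simp only [mul_pow]; ring
        _ ≤ _ := by
          rw [e1]
          have : 0 ≤ (1 - (q : ℝ) / M) * (K * M) := mul_nonneg (by linarith) (by positivity)
          gcongr
    exact_mod_cast this
  have hpos : 0 < M ^ e * (K * M) ^ r := by positivity
  refine Nat.le_of_mul_le_mul_left ?_ hpos
  calc M ^ e * (K * M) ^ r * (3 * (Ny * (P ^ 2 * h)))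
      = 3 * (M ^ e * (K * M) ^ r) * (Ny * (P ^ 2 * h)) := by ring
    _ ≤ 4 * ((M - q) ^ e * (K * M - q) ^ r) * (Ny * (P ^ 2 * h)) := by gcongr
    _ = 4 * ((Ny * (K * M - q) ^ r) * ((M - q) ^ e * (P ^ 2 * h))) := by ring
    _ ≤ 4 * (Ωy * (Nn * (K * M) ^ r * M ^ e)) := by gcongr
    _ = _ := by ring

end Counting

/-! ### Expansion of 24 random permutations -/

section Expansion

variable {X : Type*} [Fintype X] [DecidableEq X]

-- Switching the image of `x` bounds the conditional probability by `(|B| - |A|) / (|X| - |A|)`,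
-- which is at most `|B| / |X|`.
open Classical in
theorem card_mapsTo_insert_mul_le (A B : Finset X) {x : X} (hx : x ∉ A) :
    (univ.filter fun π : Equiv.Perm X => ∀ u ∈ insert x A, π u ∈ B).card * Fintype.card X ≤
      (univ.filter fun π : Equiv.Perm X => ∀ u ∈ A, π u ∈ B).card * B.card := by
  set N₁ := univ.filter fun π : Equiv.Perm X => ∀ u ∈ insert x A, π u ∈ B with hN₁
  set N := univ.filter fun π : Equiv.Perm X => ∀ u ∈ A, π u ∈ B with hN
  have key : N₁.card * (Fintype.card X - A.card) ≤ N.card * (B.card - A.card) := by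
    calc N₁.card * (Fintype.card X - A.card)
        = (N₁.sigma fun π => univ \ A.image π).card := by
          rw [card_sigma, ← smul_eq_mul, ← sum_const]
          refine sum_congr rfl fun π _ => ?_
          rw [card_sdiff_of_subset (subset_univ _), card_univ, card_image_of_injective _ π.injective]
      _ ≤ (N.sigma fun π => B \ A.image π).card := by
          refine card_le_card_of_injOn
            (fun q => ⟨Equiv.swap (q.1 x) q.2 * q.1, q.1 x⟩) ?_ ?_
          · rintro ⟨π, y⟩ hq
            simp only [coe_sigma, Set.mem_sigma_iff, mem_coe, mem_sdiff, mem_filter, mem_univ,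
              true_and, hN, hN₁, mem_image, not_exists, not_and] at hq ⊢
            obtain ⟨h1, h2⟩ := hq
            have hfix : ∀ u ∈ A, (Equiv.swap (π x) y * π) u = π u := by
              intro u hu
              rw [Equiv.Perm.mul_apply, Equiv.swap_apply_of_ne_of_ne]
              · intro h
                exact hx (π.injective h ▸ hu)
              · exact h2 u hu
            refine ⟨fun u hu => ?_, h1 x (mem_insert_self _ _), fun u hu => ?_⟩
            · rw [hfix u hu]
              exact h1 u (mem_insert_of_mem hu)
            · rw [hfix u hu]
              intro h
              exact hx (π.injective h ▸ hu)
          · rintro ⟨π, y⟩ _ ⟨π', y'⟩ _ heq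
            simp only [Sigma.mk.injEq, heq_eq_eq] at heq
            obtain ⟨h1, h2⟩ := heq
            have h3 := congrArg (fun f : Equiv.Perm X => f x) h1
            simp only [Equiv.Perm.mul_apply, Equiv.swap_apply_left] at h3
            subst h3
            rw [h2] at h1
            rw [mul_right_injective _ h1]
      _ = ∑ π ∈ N, (B \ A.image π).card := card_sigma _ _
      _ = N.card * (B.card - A.card) := by
          rw [← smul_eq_mul, ← sum_const]
          refine sum_congr rfl fun π hπ => ?_
          rw [card_sdiff_of_subset, card_image_of_injective _ π.injective]
          intro y hy
          obtain ⟨u, hu, rfl⟩ := mem_image.1 hy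
          exact (mem_filter.1 hπ).2 u hu
  have hA : A.card < Fintype.card X := by
    rw [← card_univ]
    exact card_lt_card (Finset.ssubset_iff_subset_ne.2 ⟨subset_univ _, fun h => hx (h ▸ mem_univ x)⟩)
  have hB : B.card ≤ Fintype.card X := card_le_univ B
  have h2 : (B.card - A.card) * Fintype.card X ≤ B.card * (Fintype.card X - A.card) := by
    rw [Nat.sub_mul, Nat.mul_sub]
    have : B.card * A.card ≤ A.card * Fintype.card X := by
      rw [mul_comm]; exact Nat.mul_le_mul_left _ hB
    omega
  refine Nat.le_of_mul_le_mul_right ?_ (Nat.sub_pos_of_lt hA)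
  calc _ = N₁.card * (Fintype.card X - A.card) * Fintype.card X := by ring
    _ ≤ N.card * (B.card - A.card) * Fintype.card X := by gcongr
    _ = N.card * ((B.card - A.card) * Fintype.card X) := by ring
    _ ≤ N.card * (B.card * (Fintype.card X - A.card)) := by gcongr
    _ = _ := by ring

open Classical in
theorem card_mapsTo_mul_le (A B : Finset X) :
    (univ.filter fun π : Equiv.Perm X => ∀ u ∈ A, π u ∈ B).card * Fintype.card X ^ A.card ≤
      B.card ^ A.card * Fintype.card (Equiv.Perm X) := by
  induction A using Finset.induction_on with
  | empty => simp
  | insert x A hx ih =>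
    rw [card_insert_of_notMem hx, pow_succ', pow_succ', ← mul_assoc]
    refine (Nat.mul_le_mul_right _ (card_mapsTo_insert_mul_le A B hx)).trans ?_
    calc _ = B.card * ((univ.filter fun π : Equiv.Perm X => ∀ u ∈ A, π u ∈ B).card *
          Fintype.card X ^ A.card) := by ring
      _ ≤ B.card * (B.card ^ A.card * Fintype.card (Equiv.Perm X)) := by gcongr
      _ = _ := by ring

/-- Every set of at most half of the points has, under the permutations together, an image that
is larger by a factor of more than `3/2`, rounded down. -/
def IsExpanding {s : ℕ} (π : Fin s → Equiv.Perm X) : Prop :=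
  ∀ A B : Finset X, A.Nonempty → 2 * A.card ≤ Fintype.card X → B.card = 3 * A.card / 2 →
    ∃ b, ∃ x ∈ A, π b x ∉ B

theorem choose_le_exp_pow {m a : ℕ} (ha : 0 < a) :
    (m.choose a : ℝ) ≤ (Real.exp 1 * (m / a)) ^ a := by
  have h1 : (m.choose a : ℝ) ≤ (m : ℝ) ^ a / a.factorial := Nat.choose_le_pow_div a m
  have h2 : (a : ℝ) ^ a / a.factorial ≤ Real.exp 1 ^ a := by
    have := Real.pow_div_factorial_le_exp (a : ℝ) (by positivity) a
    rwa [← Real.exp_nat_mul, mul_one]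
  have ha' : (0 : ℝ) < a := by exact_mod_cast ha
  calc (m.choose a : ℝ) ≤ (m : ℝ) ^ a / a.factorial := h1
    _ = (a : ℝ) ^ a / a.factorial * (m / a) ^ a := by rw [div_pow]; field_simp
    _ ≤ Real.exp 1 ^ a * (m / a) ^ a := by gcongr
    _ = _ := (mul_pow _ _ _).symm

/-- With `b = 3 * a / 2 ≤ 2 * a`, the binomials are at most the `a`-th powers of `3/2 * e * (m / b)`
and `(e * (m / b)) ^ 2`. Three of the 24 factors `b / m` cancel the powers of `m / b`; the other 21
are at most `3/4` each and beat the constant `3/2 * e ^ 3`. -/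
theorem choose_mul_choose_mul_le {m a : ℕ} (ha : 0 < a) (ham : 2 * a ≤ m) :
    (m.choose a : ℝ) * m.choose (3 * a / 2) * (((3 * a / 2 : ℕ) : ℝ) / m) ^ (a * 24) ≤
      (1 / 9) ^ a := by
  set b := 3 * a / 2 with hb
  have hb0 : 0 < b := by omega
  have hbm : 4 * b ≤ 3 * m := by omega
  have hba : b ≤ 2 * a := by omega
  have hab : 2 * b ≤ 3 * a := by omega
  have hbm' : b ≤ m := by omega
  have hm : (0 : ℝ) < m := by exact_mod_cast (by omega : 0 < m)
  have hbr : (0 : ℝ) < b := by exact_mod_cast hb0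
  have har : (0 : ℝ) < a := by exact_mod_cast ha
  have hmb : (1 : ℝ) ≤ m / b := by rw [le_div_iff₀ hbr]; simpa using by exact_mod_cast hbm'
  have he1 : (1 : ℝ) ≤ Real.exp 1 := Real.one_le_exp (by norm_num)
  have h1 : (m.choose a : ℝ) ≤ (Real.exp 1 * (3 / 2 * (m / b))) ^ a := by
    refine (choose_le_exp_pow ha).trans ?_
    have : (m : ℝ) / a ≤ 3 / 2 * (m / b) := by
      rw [div_le_iff₀ har]
      have : (2 * b : ℝ) ≤ 3 * a := by exact_mod_cast hab
      have h3 : 3 / 2 * ((m : ℝ) / b) * a = m * (3 * a / (2 * b)) := by field_simp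
      rw [h3]
      exact le_mul_of_one_le_right hm.le (by rw [le_div_iff₀ (by positivity)]; linarith)
    gcongr
  have h2 : (m.choose b : ℝ) ≤ ((Real.exp 1 * (m / b)) ^ 2) ^ a := by
    refine (choose_le_exp_pow hb0).trans ?_
    rw [← pow_mul]
    exact pow_le_pow_right₀ (one_le_mul_of_one_le_of_one_le he1 hmb) hba
  have hexp : 3 / 2 * Real.exp 1 ^ 3 * (3 / 4 : ℝ) ^ 21 ≤ 1 / 9 := by
    have : Real.exp 1 ^ 3 ≤ 2.7182818286 ^ 3 := by
      gcongr; exact Real.exp_one_lt_d9.le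
    calc 3 / 2 * Real.exp 1 ^ 3 * (3 / 4 : ℝ) ^ 21
        ≤ 3 / 2 * 2.7182818286 ^ 3 * (3 / 4 : ℝ) ^ 21 := by gcongr
      _ ≤ 1 / 9 := by norm_num
  have hu : (b : ℝ) / m ≤ 3 / 4 := by
    rw [div_le_iff₀ hm]
    have : (4 * b : ℝ) ≤ 3 * m := by exact_mod_cast hbm
    linarith
  calc _ ≤ (Real.exp 1 * (3 / 2 * (m / b))) ^ a * ((Real.exp 1 * (m / b)) ^ 2) ^ a *
        ((b : ℝ) / m) ^ (a * 24) := by gcongr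
    _ = (3 / 2 * Real.exp 1 ^ 3 * (b / m : ℝ) ^ 21) ^ a := by
      rw [mul_comm a 24, pow_mul, ← mul_pow, ← mul_pow]
      congr 1
      field_simp
    _ ≤ (3 / 2 * Real.exp 1 ^ 3 * (3 / 4 : ℝ) ^ 21) ^ a := by gcongr
    _ ≤ _ := by gcongr

theorem sum_ninth_le (n : ℕ) : ∑ a ∈ Icc 1 n, (1 / 9 : ℝ) ^ a ≤ 1 / 8 := by
  have h : ∑ a ∈ Icc 1 n, (1 / 9 : ℝ) ^ a = 1 / 8 - 1 / 8 * (1 / 9) ^ n := by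
    induction n with
    | zero => simp
    | succ n ih =>
      rw [sum_Icc_succ_top (by omega), ih, pow_succ]
      ring
  rw [h]
  have : (0 : ℝ) ≤ 1 / 8 * (1 / 9) ^ n := by positivity
  linarith

-- Union bound over the pairs `A`, `B` that violate expansion. The permutations are independent, so
-- all 24 map `A` into `B` with probability at most `(|B| / m) ^ (24 * |A|)`, and summing over sizes
-- gives a geometric series of ratio `1/9`.
open Classical in
theorem card_not_isExpanding_le :
    8 * (univ.filter fun π : Fin 24 → Equiv.Perm X => ¬ IsExpanding π).card ≤
      Fintype.card (Fin 24 → Equiv.Perm X) := by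
  set m := Fintype.card X with hm
  set Ω := Fintype.card (Fin 24 → Equiv.Perm X) with hΩ
  have hΩ' : Ω = Fintype.card (Equiv.Perm X) ^ 24 := by simp [hΩ]
  let bad (A B : Finset X) := univ.filter fun π : Fin 24 → Equiv.Perm X => ∀ b, ∀ x ∈ A, π b x ∈ B
  have hbad : ∀ A B : Finset X, 0 < m →
      ((bad A B).card : ℝ) ≤ ((B.card : ℝ) / m) ^ (A.card * 24) * Ω := by
    intro A B hm0
    have h1 : (bad A B).card =
        (univ.filter fun π : Equiv.Perm X => ∀ u ∈ A, π u ∈ B).card ^ 24 := by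
      have : bad A B = Fintype.piFinset fun _ : Fin 24 =>
          univ.filter fun π : Equiv.Perm X => ∀ u ∈ A, π u ∈ B := by
        ext π; simp [bad]
      rw [this, Fintype.card_piFinset_const]
    have h2 := card_mapsTo_mul_le A B
    rw [h1, hΩ', pow_mul]
    push_cast
    rw [← mul_pow]
    gcongr
    rw [div_pow, div_mul_eq_mul_div, le_div_iff₀ (by positivity)]
    exact_mod_cast h2
  have hsub : (univ.filter fun π : Fin 24 → Equiv.Perm X => ¬ IsExpanding π) ⊆
      (Icc 1 m).biUnion fun a => if 2 * a ≤ m then (powersetCard a univ).biUnion fun A =>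
        (powersetCard (3 * a / 2) univ).biUnion fun B => bad A B else ∅ := by
    intro π hπ
    have hπ' := (mem_filter.1 hπ).2
    unfold IsExpanding at hπ'
    push Not at hπ'
    obtain ⟨A, B, hA, hAm, hB, h⟩ := hπ'
    rw [mem_biUnion]
    refine ⟨A.card, mem_Icc.2 ⟨hA.card_pos, card_le_univ A⟩, ?_⟩
    rw [if_pos hAm]
    simp only [mem_biUnion, mem_powersetCard, subset_univ, true_and, bad, mem_filter, mem_univ]
    exact ⟨A, rfl, B, hB, h⟩
  have hcard : ∀ a ∈ Icc 1 m, ((if 2 * a ≤ m then (powersetCard a univ).biUnion fun A =>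
        (powersetCard (3 * a / 2) univ).biUnion fun B => bad A B else ∅ : Finset _).card : ℝ) ≤
        (1 / 9) ^ a * Ω := by
    intro a ha
    rw [mem_Icc] at ha
    split_ifs with h
    · have h1 : (((powersetCard a univ).biUnion fun A : Finset X =>
          (powersetCard (3 * a / 2) univ).biUnion fun B => bad A B).card : ℝ) ≤
          ∑ A ∈ powersetCard a (univ : Finset X), ∑ B ∈ powersetCard (3 * a / 2) (univ : Finset X),
            ((bad A B).card : ℝ) := by
        have : ((powersetCard a univ).biUnion fun A : Finset X =>
          (powersetCard (3 * a / 2) univ).biUnion fun B => bad A B).card ≤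
          ∑ A ∈ powersetCard a (univ : Finset X), ∑ B ∈ powersetCard (3 * a / 2) (univ : Finset X),
            (bad A B).card :=
          card_biUnion_le.trans (sum_le_sum fun A _ => card_biUnion_le)
        exact_mod_cast this
      refine h1.trans ?_
      calc _ ≤ ∑ A ∈ powersetCard a (univ : Finset X),
            ∑ B ∈ powersetCard (3 * a / 2) (univ : Finset X),
              (((3 * a / 2 : ℕ) : ℝ) / m) ^ (a * 24) * Ω := by
            refine sum_le_sum fun A hA => sum_le_sum fun B hB => ?_
            have h2 := hbad A B (by omega)
            rwa [(mem_powersetCard.1 hA).2, (mem_powersetCard.1 hB).2] at h2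
        _ = (m.choose a : ℝ) * m.choose (3 * a / 2) *
              (((3 * a / 2 : ℕ) : ℝ) / m) ^ (a * 24) * Ω := by
            simp only [sum_const, card_powersetCard, card_univ, nsmul_eq_mul, ← hm]
            ring
        _ ≤ _ := by
            gcongr
            exact choose_mul_choose_mul_le (by omega) h
    · simp only [card_empty, CharP.cast_eq_zero]
      positivity
  have : ((univ.filter fun π : Fin 24 → Equiv.Perm X => ¬ IsExpanding π).card : ℝ) ≤
      1 / 8 * Ω := by
    calc _ ≤ (((Icc 1 m).biUnion fun a => if 2 * a ≤ m then
          (powersetCard a univ).biUnion fun A =>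
          (powersetCard (3 * a / 2) univ).biUnion fun B => bad A B else ∅).card : ℝ) := by
          exact_mod_cast card_le_card hsub
      _ ≤ ∑ a ∈ Icc 1 m, ((if 2 * a ≤ m then (powersetCard a univ).biUnion fun A =>
        (powersetCard (3 * a / 2) univ).biUnion fun B => bad A B else ∅ : Finset _).card : ℝ) := by
          exact_mod_cast card_biUnion_le
      _ ≤ ∑ a ∈ Icc 1 m, (1 / 9 : ℝ) ^ a * Ω := sum_le_sum hcard
      _ = (∑ a ∈ Icc 1 m, (1 / 9 : ℝ) ^ a) * Ω := (sum_mul _ _ _).symm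
      _ ≤ _ := by gcongr; exact sum_ninth_le m
  have h8 : (8 * (univ.filter fun π : Fin 24 → Equiv.Perm X => ¬ IsExpanding π).card : ℝ) ≤ Ω := by
    linarith
  exact_mod_cast h8

open Classical in
theorem card_isExpanding_ge :
    3 * Fintype.card (Fin 24 → Equiv.Perm X) ≤
      4 * (univ.filter fun π : Fin 24 → Equiv.Perm X =>
        IsExpanding π ∧ IsExpanding fun b => (π b)⁻¹).card := by
  have h1 := card_not_isExpanding_le (X := X)
  have h2 : (univ.filter fun π : Fin 24 → Equiv.Perm X => ¬ IsExpanding fun b => (π b)⁻¹).card =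
      (univ.filter fun π : Fin 24 → Equiv.Perm X => ¬ IsExpanding π).card := by
    refine card_equiv (Equiv.inv _) fun π => ?_
    simp only [mem_filter, mem_univ, true_and, Equiv.inv_apply]
    rfl
  have h3 : Fintype.card (Fin 24 → Equiv.Perm X) ≤
      (univ.filter fun π : Fin 24 → Equiv.Perm X =>
        IsExpanding π ∧ IsExpanding fun b => (π b)⁻¹).card +
      ((univ.filter fun π : Fin 24 → Equiv.Perm X => ¬ IsExpanding π).card +
      (univ.filter fun π : Fin 24 → Equiv.Perm X => ¬ IsExpanding fun b => (π b)⁻¹).card) := by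
    rw [← card_univ]
    refine le_trans (card_le_card fun π _ => ?_) ((card_union_le _ _).trans
      (Nat.add_le_add_left (card_union_le _ _) _))
    simp only [mem_union, mem_filter, mem_univ, true_and]
    tauto
  omega

end Expansion

/-! ### The blowup graph and its cliques -/

section Blowup

variable {X : Type*} {s d : ℕ}

/-- The `b`-th permutation or, on the other side, its inverse. -/
def partner (π : Fin s → Equiv.Perm X) (e : Bool) (b : Fin s) : Equiv.Perm X :=
  if e then π b else (π b)⁻¹

theorem partner_not_partner (π : Fin s → Equiv.Perm X) (e : Bool) (b : Fin s) (x : X) :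
    partner π (!e) b (partner π e b x) = x := by
  cases e <;> simp [partner]

/-- The vertices: each point on either of two sides is replaced by `s` blocks of `d` vertices. -/
abbrev BlowupVertex (X : Type*) (s d : ℕ) := Bool × X × Fin s × Fin d

/-- All vertices over the same point are adjacent, and the `b`-th block over a point is completely
joined with the `b`-th block over the image of this point under the `b`-th permutation. -/
def blowup (π : Fin s → Equiv.Perm X) (d : ℕ) : SimpleGraph (BlowupVertex X s d) where
  Adj w w' := (w.1 = w'.1 ∧ w.2.1 = w'.2.1 ∧ w.2.2 ≠ w'.2.2) ∨
    (w'.1 = !w.1 ∧ w'.2.1 = partner π w.1 w.2.2.1 w.2.1 ∧ w'.2.2.1 = w.2.2.1)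
  symm := ⟨by
    rintro ⟨e, x, b, a⟩ ⟨e', x', b', a'⟩ h
    simp only at h
    rcases h with ⟨rfl, rfl, h⟩ | ⟨rfl, rfl, rfl⟩
    · exact Or.inl ⟨rfl, rfl, h.symm⟩
    · exact Or.inr ⟨by simp, by simp [partner_not_partner], rfl⟩⟩
  loopless := ⟨by
    rintro ⟨e, x, b, a⟩ (⟨_, _, h⟩ | ⟨h, _⟩)
    · exact h rfl
    · simp at h⟩

/-- The vertices in the cells: over a point, or in two joined blocks. -/
def CellMem (π : Fin s → Equiv.Perm X) : (Bool × X) ⊕ (Fin s × X) → BlowupVertex X s d → Prop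
  | .inl q, w => w.1 = q.1 ∧ w.2.1 = q.2
  | .inr q, w => w.2.2.1 = q.1 ∧ w.2.1 = if w.1 then q.2 else π q.1 q.2

theorem CellMem.adj {π : Fin s → Equiv.Perm X} {i : (Bool × X) ⊕ (Fin s × X)}
    {w w' : BlowupVertex X s d} (h : CellMem π i w) (h' : CellMem π i w') (hne : w ≠ w') :
    (blowup π d).Adj w w' := by
  obtain ⟨e, x, b, a⟩ := w
  obtain ⟨e', x', b', a'⟩ := w'
  rcases i with ⟨f, y⟩ | ⟨c, y⟩
  · obtain ⟨rfl, rfl⟩ := h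
    obtain ⟨h1, h2⟩ := h'
    simp only at h1 h2
    subst h1 h2
    exact Or.inl ⟨rfl, rfl, fun h => hne (by simp only at h; rw [h])⟩
  · obtain ⟨rfl, h1⟩ := h
    obtain ⟨h2, h3⟩ := h'
    simp only at h1 h2 h3
    subst h2 h1 h3
    cases e <;> cases e'
    · exact Or.inl ⟨rfl, rfl, fun h => hne (by simp only at h; rw [h])⟩
    · exact Or.inr ⟨rfl, by simp [partner], rfl⟩
    · exact Or.inr ⟨rfl, by simp [partner], rfl⟩
    · exact Or.inl ⟨rfl, rfl, fun h => hne (by simp only at h; rw [h])⟩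

/-- A clique on one side lies over one point. In a clique meeting both sides, each edge between the
sides forces equal block indices and matched points, and injectivity of the permutation then fixes a
single pair of blocks. -/
theorem exists_cellMem {π : Fin s → Equiv.Perm X} {σ : Set (BlowupVertex X s d)}
    (hσ : (blowup π d).IsClique σ) {w : BlowupVertex X s d} (hw : w ∈ σ) :
    ∃ i, ∀ u ∈ σ, CellMem π i u := by
  by_cases hside : ∀ u ∈ σ, u.1 = w.1
  · refine ⟨.inl (w.1, w.2.1), fun u hu => ⟨hside u hu, ?_⟩⟩
    rcases eq_or_ne u w with rfl | hne
    · rfl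
    · rcases hσ hu hw hne with h | h
      · exact h.2.1
      · have := h.1
        rw [hside u hu] at this
        simp at this
  · push Not at hside
    obtain ⟨v, hv, hvw⟩ := hside
    have key : ∀ w ∈ σ, ∀ v ∈ σ, w.1 = true → v.1 = false → ∀ u ∈ σ,
        CellMem π (.inr (w.2.2.1, w.2.1)) u := by
      intro w hw v hv hw1 hv1 u hu
      have hopp : ∀ a ∈ σ, ∀ b ∈ σ, a.1 = true → b.1 = false →
          b.2.1 = π a.2.2.1 a.2.1 ∧ b.2.2.1 = a.2.2.1 := by
        intro a ha b hb h1 h2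
        rcases hσ ha hb (by rintro rfl; simp_all) with h | h
        · simp_all
        · have h3 := h.2.1
          rw [h1] at h3
          exact ⟨by simpa [partner] using h3, h.2.2⟩
      have hwv := hopp w hw v hv hw1 hv1
      cases hu1 : u.1
      · have := hopp w hw u hu hw1 hu1
        exact ⟨this.2, by rw [hu1]; simpa using this.1⟩
      · have := hopp u hu v hv hu1 hv1
        have hb : u.2.2.1 = w.2.2.1 := this.2.symm.trans hwv.2
        refine ⟨hb, ?_⟩
        rw [hu1, if_pos rfl]
        have h3 := this.1.symm.trans hwv.1
        rw [hb] at h3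
        exact (π _).injective h3
    cases hw1 : w.1
    · exact ⟨_, key v hv w hw (by simpa [hw1] using hvw) hw1⟩
    · exact ⟨_, key w hw v hv hw1 (by simpa [hw1] using hvw)⟩

end Blowup

/-! ### Blowups of expanding permutations form a single cluster -/

section Cover

variable {X : Type*} [Fintype X] {s d : ℕ} {V : Type*}

open Classical in
/-- The cells as sets of vertices of the ambient vertex set. -/
noncomputable def cell (π : Fin s → Equiv.Perm X) (ι : BlowupVertex X s d ↪ V)
    (i : (Bool × X) ⊕ (Fin s × X)) : Finset V :=
  (univ.filter (CellMem π i)).map ι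

theorem mem_cell {π : Fin s → Equiv.Perm X} {ι : BlowupVertex X s d ↪ V}
    {i : (Bool × X) ⊕ (Fin s × X)} {v : V} : v ∈ cell π ι i ↔ ∃ w, CellMem π i w ∧ ι w = v := by
  simp [cell]

theorem apply_mem_cell {π : Fin s → Equiv.Perm X} {ι : BlowupVertex X s d ↪ V}
    {i : (Bool × X) ⊕ (Fin s × X)} {w : BlowupVertex X s d} :
    ι w ∈ cell π ι i ↔ CellMem π i w := by
  rw [mem_cell]
  exact ⟨fun ⟨w', h, h'⟩ => ι.injective h' ▸ h, fun h => ⟨w, h, rfl⟩⟩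

/-- The point at the end of the pair cell `(b, x)` on the side `e`. -/
def endpoint (π : Fin s → Equiv.Perm X) (e : Bool) (b : Fin s) (x : X) : X :=
  if e then x else π b x

-- A point cell and a pair cell ending there share a block. Blocks have `d` vertices so that such
-- cells have a common `r`-face for every `r < d`.
open Classical in
theorem le_card_cell_inter_cell (π : Fin s → Equiv.Perm X) (ι : BlowupVertex X s d ↪ V) (e : Bool)
    (b : Fin s) (x : X) :
    d ≤ (cell π ι (.inl (e, endpoint π e b x)) ∩ cell π ι (.inr (b, x))).card := by
  calc d = (univ.image fun a : Fin d => ι (e, endpoint π e b x, b, a)).card := by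
        rw [card_image_of_injective _ (fun a a' h => by simpa using h), card_univ, Fintype.card_fin]
    _ ≤ _ := by
        refine card_le_card fun v hv => ?_
        obtain ⟨a, -, rfl⟩ := mem_image.1 hv
        rw [mem_inter, apply_mem_cell, apply_mem_cell]
        exact ⟨⟨rfl, rfl⟩, rfl, rfl⟩

theorem isCellCover_cell [DecidableEq X] (π : Fin s → Equiv.Perm X) (ι : BlowupVertex X s d ↪ V) (hs : 2 ≤ s)
    (hd : 1 ≤ d) : IsCellCover ((blowup π d).map ι) d (s * d) (cell π ι) := by
  classical
  refine ⟨?_, ?_, ?_, ?_, ?_⟩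
  · intro i u hu v hv huv
    obtain ⟨w, hw, rfl⟩ := mem_cell.1 hu
    obtain ⟨w', hw', rfl⟩ := mem_cell.1 hv
    rw [SimpleGraph.map_adj_apply]
    exact hw.adj hw' (fun h => huv (by rw [h]))
  · rintro (⟨e, x⟩ | ⟨b, x⟩)
    · calc d < s * d := by nlinarith
        _ = (univ.image fun p : Fin s × Fin d => ι (e, x, p)).card := by
          rw [card_image_of_injective _ (fun a a' h => by simpa using h)]
          simp
        _ ≤ _ := by
          refine card_le_card fun v hv => ?_
          obtain ⟨p, -, rfl⟩ := mem_image.1 hv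
          rw [apply_mem_cell]
          exact ⟨rfl, rfl⟩
    · calc d < 2 * d := by omega
        _ = (univ.image fun p : Bool × Fin d => ι (p.1, endpoint π p.1 b x, b, p.2)).card := by
          rw [card_image_of_injective]
          · simp
          · rintro ⟨e, a⟩ ⟨e', a'⟩ h
            have := ι.injective h
            simp only [Prod.mk.injEq] at this ⊢
            exact ⟨this.1, this.2.2.2⟩
        _ ≤ _ := by
          refine card_le_card fun v hv => ?_
          obtain ⟨p, -, rfl⟩ := mem_image.1 hv
          rw [apply_mem_cell]
          exact ⟨rfl, rfl⟩
  · rintro (⟨e, x⟩ | ⟨b, x⟩)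
    · rw [cell, card_map]
      calc _ ≤ (univ : Finset (Fin s × Fin d)).card := by
            refine card_le_card_of_injOn (fun w => w.2.2) (fun _ _ => mem_coe.2 (mem_univ _)) ?_
            rintro ⟨e1, x1, p1⟩ h1 ⟨e2, x2, p2⟩ h2 h
            simp only [coe_filter, mem_univ, true_and, Set.mem_ofPred_eq, CellMem] at h1 h2 h
            rw [h1.1, h1.2, h2.1, h2.2, h]
        _ = s * d := by simp
    · rw [cell, card_map]
      calc _ ≤ (univ : Finset (Bool × Fin d)).card := by
            refine card_le_card_of_injOn (fun w => (w.1, w.2.2.2))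
              (fun _ _ => mem_coe.2 (mem_univ _)) ?_
            rintro ⟨e1, x1, b1, a1⟩ h1 ⟨e2, x2, b2, a2⟩ h2 h
            simp only [coe_filter, mem_univ, true_and, Set.mem_ofPred_eq, CellMem,
              Prod.mk.injEq] at h1 h2 h
            rw [h1.1, h1.2, h2.1, h2.2, h.1, h.2]
        _ = 2 * d := by simp
        _ ≤ s * d := Nat.mul_le_mul_right _ hs
  · intro σ hσ h2
    have hex : ∀ v ∈ σ, ∃ w, ι w = v := by
      intro v hv
      obtain ⟨u, hu, huv⟩ := exists_mem_ne (by omega : 1 < σ.card) v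
      have := hσ hv hu huv.symm
      rw [SimpleGraph.map_adj] at this
      obtain ⟨w, _, _, h, _⟩ := this
      exact ⟨w, h⟩
    obtain ⟨v, hv⟩ : σ.Nonempty := card_pos.1 (by omega)
    obtain ⟨w, rfl⟩ := hex v hv
    have hclique : (blowup π d).IsClique {w | ι w ∈ σ} := by
      intro a ha b hb hab
      have := hσ ha hb (fun h => hab (ι.injective h))
      rwa [SimpleGraph.map_adj_apply] at this
    obtain ⟨i, hi⟩ := exists_cellMem hclique hv
    refine ⟨i, fun u hu => ?_⟩
    obtain ⟨w', rfl⟩ := hex u hu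
    exact apply_mem_cell.2 (hi w' hu)
  · intro v
    by_cases h : ∃ w, ι w = v
    · obtain ⟨⟨e, x, b, a⟩, rfl⟩ := h
      refine ⟨{.inl (e, x), .inr (b, if e then x else (π b)⁻¹ x)}, card_le_two, fun l hl => ?_⟩
      rw [apply_mem_cell] at hl
      rw [mem_insert, mem_singleton]
      rcases l with ⟨e', x'⟩ | ⟨b', x'⟩
      · obtain ⟨h1, h2⟩ := hl
        simp only at h1 h2
        subst h1 h2
        exact Or.inl rfl
      · obtain ⟨h1, h2⟩ := hl
        simp only at h1 h2
        subst h1 h2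
        right
        cases e <;> simp
    · exact ⟨∅, by simp, fun l hl => absurd (mem_cell.1 hl) (by tauto)⟩

variable [DecidableEq X]

/-- Expansion is applied to a subset of `P` with at most half of the points. Its images lie in `Q ∪
N` and number more than `3/2` times its size, rounded down, while `Q` is no larger than `P` and than
the complement of `P`, so the excess falls into `N`. -/
theorem IsExpanding.card_add_card_le {π : Fin s → Equiv.Perm X} (h : IsExpanding π)
    (hX : 2 ≤ Fintype.card X) {P Q N : Finset X} (hQP : Q.card ≤ P.card)
    (hPQ : P.card + Q.card ≤ Fintype.card X) (hN : ∀ b, ∀ x ∈ P, π b x ∉ Q → π b x ∈ N) :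
    P.card + Q.card ≤ 4 * N.card := by
  rcases P.eq_empty_or_nonempty with rfl | hP
  · simp only [card_empty] at hQP ⊢
    omega
  have hP0 := hP.card_pos
  obtain ⟨P', hP', hP'c⟩ := exists_subset_card_eq
    (min_le_left P.card (Fintype.card X / 2))
  have hbig : 3 * P'.card / 2 < (Q ∪ N).card := by
    by_contra! hcon
    obtain ⟨B, hB, -, hBc⟩ := exists_subsuperset_card_eq (subset_univ (Q ∪ N)) hcon
      (by rw [card_univ]; omega)
    obtain ⟨b, x, hx, hxB⟩ := h P' B (card_pos.1 (by omega)) (by omega) hBc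
    refine hxB (hB ?_)
    rw [mem_union]
    by_cases hQ : π b x ∈ Q
    · exact Or.inl hQ
    · exact Or.inr (hN b x (hP' hx) hQ)
  have := card_union_le Q N
  omega

theorem card_le_of_separated {π : Fin s → Equiv.Perm X} (h : IsExpanding π)
    (h' : IsExpanding fun b => (π b)⁻¹) (hX : 2 ≤ Fintype.card X)
    {A B : Finset ((Bool × X) ⊕ (Fin s × X))}
    (hsep : ∀ e b x, .inl (e, endpoint π e b x) ∈ A → .inr (b, x) ∉ B)
    (hsep' : ∀ e b x, .inl (e, endpoint π e b x) ∈ B → .inr (b, x) ∉ A)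
    (hA : (univ.filter fun x => Sum.inl (true, x) ∈ A).card +
      (univ.filter fun x => Sum.inl (false, x) ∈ A).card ≤ Fintype.card X) :
    A.card ≤ (5 * s + 4) * (univ \ (A ∪ B)).card := by
  set AL := univ.filter fun x => Sum.inl (true, x) ∈ A with hAL
  set AR := univ.filter fun x => Sum.inl (false, x) ∈ A with hAR
  set R := univ \ (A ∪ B) with hR
  have hmR : ∀ i, i ∈ R ↔ i ∉ A ∧ i ∉ B := by intro i; simp [hR]
  -- Expansion starts from the side with more points in `A`. An image point outside of `A` yields a
  -- cell in `R` that `g` sends to this point: its own point cell or, if that is in `B`, the pair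
  -- cell leading to it, which can belong neither to `A` nor to `B`.
  have hbase : AL.card + AR.card ≤ 4 * R.card := by
    rcases le_total AR.card AL.card with hle | hle
    · let g : (Bool × X) ⊕ (Fin s × X) → X := Sum.elim (fun q => q.2) (fun q => π q.1 q.2)
      refine (h.card_add_card_le hX hle hA (N := R.image g) fun b x hx hxR => ?_).trans
        (Nat.mul_le_mul_left _ card_image_le)
      simp only [hAL, hAR, mem_filter, mem_univ, true_and] at hx hxR
      rw [mem_image]
      by_cases hp : .inl (false, π b x) ∈ R
      · exact ⟨_, hp, rfl⟩
      · refine ⟨.inr (b, x), ?_, rfl⟩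
        have hB : .inl (false, π b x) ∈ B := by
          by_contra hcon
          exact hp ((hmR _).2 ⟨hxR, hcon⟩)
        exact (hmR _).2 ⟨hsep' false b x hB, hsep true b x hx⟩
    · let g : (Bool × X) ⊕ (Fin s × X) → X := Sum.elim (fun q => q.2) (fun q => q.2)
      rw [add_comm] at hA ⊢
      refine (h'.card_add_card_le hX hle hA (N := R.image g) fun b y hy hyL => ?_).trans
        (Nat.mul_le_mul_left _ card_image_le)
      simp only [hAL, hAR, mem_filter, mem_univ, true_and] at hy hyL
      rw [mem_image]
      obtain ⟨x, rfl⟩ := (π b).surjective y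
      simp only [Equiv.Perm.inv_def, Equiv.symm_apply_apply] at hyL ⊢
      by_cases hp : .inl (true, x) ∈ R
      · exact ⟨_, hp, rfl⟩
      · refine ⟨.inr (b, x), ?_, rfl⟩
        have hB : .inl (true, x) ∈ B := by
          by_contra hcon
          exact hp ((hmR _).2 ⟨hyL, hcon⟩)
        exact (hmR _).2 ⟨hsep' true b x hB, hsep false b x hy⟩
  have hleft : A.toLeft.card ≤ AL.card + AR.card := by
    refine (card_le_card (t := AL.image (fun x => (true, x)) ∪ AR.image (fun x => (false, x)))
      fun q hq => ?_).trans ((card_union_le _ _).trans (add_le_add card_image_le card_image_le))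
    rw [mem_toLeft] at hq
    obtain ⟨e, x⟩ := q
    simp only [mem_union, mem_image, hAL, hAR, mem_filter, mem_univ, true_and]
    cases e
    · exact Or.inr ⟨x, hq, rfl⟩
    · exact Or.inl ⟨x, hq, rfl⟩
  -- The end on side `true` of a pair cell in `A` is not in `B`, so it is in `A` or `R`; each point
  -- is such an end for `s` pair cells.
  have hright : A.toRight.card ≤ s * (AL.card + R.card) := by
    let RL := univ.filter fun x => Sum.inl (true, x) ∈ R
    have hRL : RL.card ≤ R.card :=
      card_le_card_of_injOn (fun x => Sum.inl (true, x))
        (fun x hx => by simpa [RL] using hx) (fun x _ y _ hxy => by simpa using hxy)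
    calc A.toRight.card ≤ ((univ : Finset (Fin s)) ×ˢ (AL ∪ RL)).card := by
          refine card_le_card fun q hq => ?_
          rw [mem_toRight] at hq
          obtain ⟨b, x⟩ := q
          simp only [mem_product, mem_univ, true_and, mem_union, hAL, RL, mem_filter, hmR]
          by_cases hx : Sum.inl (true, x) ∈ A
          · exact Or.inl hx
          · exact Or.inr ⟨hx, fun hB => hsep' true b x hB hq⟩
      _ ≤ _ := by
          rw [card_product, card_univ, Fintype.card_fin]
          exact Nat.mul_le_mul_left _ ((card_union_le _ _).trans (by omega))
  rw [← card_toLeft_add_card_toRight]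
  have : s * (AL.card + R.card) ≤ s * (5 * R.card) := Nat.mul_le_mul_left _ (by omega)
  calc _ ≤ 4 * R.card + s * (5 * R.card) := by omega
    _ = _ := by ring

/-- There are `2 * |X|` point cells, so one of the disjoint classes has at most `|X|` of them and
`card_le_of_separated` applies to it. -/
theorem min_card_le_of_separated {π : Fin s → Equiv.Perm X} (h : IsExpanding π)
    (h' : IsExpanding fun b => (π b)⁻¹) (hX : 2 ≤ Fintype.card X)
    {A B : Finset ((Bool × X) ⊕ (Fin s × X))} (hAB : Disjoint A B)
    (hsep : ∀ e b x, .inl (e, endpoint π e b x) ∈ A → .inr (b, x) ∉ B)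
    (hsep' : ∀ e b x, .inl (e, endpoint π e b x) ∈ B → .inr (b, x) ∉ A) :
    min A.card B.card ≤ (5 * s + 4) * (univ \ (A ∪ B)).card := by
  have hside : ∀ e, (univ.filter fun x => Sum.inl (e, x) ∈ A).card +
      (univ.filter fun x => Sum.inl (e, x) ∈ B).card ≤ Fintype.card X := by
    intro e
    rw [← card_union_of_disjoint]
    · exact card_le_univ _
    · rw [disjoint_filter]
      intro x _ hx hx'
      exact disjoint_left.1 hAB hx hx'
  have h1 := hside true
  have h2 := hside false
  by_cases hA : (univ.filter fun x => Sum.inl (true, x) ∈ A).card +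
      (univ.filter fun x => Sum.inl (false, x) ∈ A).card ≤ Fintype.card X
  · exact (min_le_left _ _).trans (card_le_of_separated h h' hX hsep hsep' hA)
  · rw [union_comm]
    exact (min_le_right _ _).trans
      (card_le_of_separated h h' hX hsep' hsep (by omega))

/-- One part suffices, which makes the external conductance `0`. Vertices outside of the range of
`ι` are isolated and have degree `0`, so they do not affect the internal conductance. -/
theorem hasCluster_blowup [Fintype V] [DecidableEq V] {π : Fin s → Equiv.Perm X} (h : IsExpanding π)
    (h' : IsExpanding fun b => (π b)⁻¹) (hX : 2 ≤ Fintype.card X) (ι : BlowupVertex X s d ↪ V)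
    (hs : 2 ≤ s) (hd : 1 ≤ d) {k : ℕ} (hk : 1 ≤ k) {ψin ψout : ℝ}
    (hψ : ψin ≤ 1 / ((d : ℝ) * (2 * 4 ^ (s * d) * (5 * s + 4 + 1) : ℕ))) (hout : 0 ≤ ψout) :
    HasCluster ((blowup π d).map ι) d k ψin ψout := by
  obtain rfl : ‹DecidableEq V› = fun a b => Classical.propDecidable (a = b) := Subsingleton.elim _ _
  classical
  have hne : (univ : Finset V) ≠ ∅ := by
    have : Nonempty X := Fintype.card_pos_iff.1 (by omega)
    exact nonempty_iff_ne_empty.1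
      ⟨ι (true, Classical.arbitrary X, ⟨0, by omega⟩, ⟨0, by omega⟩), mem_univ _⟩
  refine ⟨Finpartition.indiscrete hne, by simp, by simpa using hk, fun A hA r hr => ?_⟩
  rw [Finpartition.indiscrete_parts, mem_singleton] at hA
  subst hA
  have hfaces : ∀ G : SimpleGraph V, facesIn G r univ = faces G r := by
    intro G; simp [facesIn]
  rw [hfaces]
  constructor
  · refine (EReal.coe_le_coe_iff.2 hψ).trans
      ((isCellCover_cell π ι hs hd).internalConductance_ge hd ?_ hr)
    intro A B hAB hsep
    have := min_card_le_of_separated h h' hX (A := A) (B := B) hAB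
      (fun e b x hA hB => absurd (hsep _ hA _ hB) (not_lt.2 ?_))
      (fun e b x hB hA => absurd (hsep _ hA _ hB) (not_lt.2 ?_))
    · convert this
    · convert le_card_cell_inter_cell π ι e b x
    · rw [inter_comm]
      convert le_card_cell_inter_cell π ι e b x
  · have : externalConductance ((blowup π d).map ι) d r (faces ((blowup π d).map ι) r)
        (faces ((blowup π d).map ι) r) = 0 := by
      simp [externalConductance, expanderFace, cochainNorm, vol]
    rw [this]
    exact hout

end Cover

/-! ### Neighbor lists of the blowup and locality of the replies -/

section Oracle

variable {X : Type*} {s d : ℕ} {V : Type*}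

/-- The neighbors of `w` in the blowup, if `y` is the partner of its point: first the ones over the
same point, then the ones over `y`. -/
noncomputable def neighborsVia (w : BlowupVertex X s d) (y : X) : List (BlowupVertex X s d) :=
  ((univ.erase w.2.2).toList.map fun p => (w.1, w.2.1, p)) ++
    (List.finRange d).map fun a => (!w.1, y, w.2.2.1, a)

theorem mem_neighborsVia {π : Fin s → Equiv.Perm X} {w w' : BlowupVertex X s d} :
    w' ∈ neighborsVia w (partner π w.1 w.2.2.1 w.2.1) ↔ (blowup π d).Adj w w' := by
  obtain ⟨e, x, b, a⟩ := w
  obtain ⟨e', x', b', a'⟩ := w'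
  simp only [neighborsVia, List.mem_append, List.mem_map, mem_toList, mem_erase, mem_univ,
    and_true, List.mem_finRange, true_and, blowup, Prod.mk.injEq, ne_eq]
  constructor
  · rintro (⟨p, hp, rfl, rfl, rfl⟩ | ⟨c, rfl, rfl, rfl, rfl⟩)
    · exact Or.inl ⟨rfl, rfl, fun h => hp (by simp [h])⟩
    · exact Or.inr ⟨rfl, rfl, rfl⟩
  · rintro (⟨rfl, rfl, h⟩ | ⟨rfl, rfl, rfl⟩)
    · exact Or.inl ⟨(b', a'), fun h' => h (by simp at h'; simp [h']), rfl, rfl, rfl⟩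
    · exact Or.inr ⟨a', rfl, rfl, rfl, rfl⟩

theorem nodup_neighborsVia (w : BlowupVertex X s d) (y : X) : (neighborsVia w y).Nodup := by
  refine List.nodup_append'.2 ⟨?_, ?_, ?_⟩
  · exact (nodup_toList _).map fun p p' h => by simpa using h
  · exact (List.nodup_finRange d).map fun p p' h => by simpa using h
  · intro u h1 h2
    obtain ⟨p, -, rfl⟩ := List.mem_map.1 h1
    obtain ⟨a, -, h⟩ := List.mem_map.1 h2
    simp at h

theorem length_neighborsVia_le (w : BlowupVertex X s d) (y : X) :
    (neighborsVia w y).length ≤ s * d + d := by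
  simp only [neighborsVia, List.length_append, List.length_map, length_toList,
    List.length_finRange, add_le_add_iff_right]
  exact card_le_univ _ |>.trans (by simp)

open Classical in
/-- The lists of neighbors in the blowup inside of an ambient vertex set. -/
noncomputable def neighborList (ι : BlowupVertex X s d ↪ V) (π : Fin s → Equiv.Perm X) (v : V) :
    List V :=
  if h : ∃ w, ι w = v then
    (neighborsVia h.choose (partner π h.choose.1 h.choose.2.2.1 h.choose.2.1)).map ι
  else []

theorem neighborList_apply (ι : BlowupVertex X s d ↪ V) (π : Fin s → Equiv.Perm X)
    (w : BlowupVertex X s d) :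
    neighborList ι π (ι w) = (neighborsVia w (partner π w.1 w.2.2.1 w.2.1)).map ι := by
  have h : ∃ w', ι w' = ι w := ⟨w, rfl⟩
  rw [neighborList, dif_pos h, ι.injective h.choose_spec]

theorem neighborList_of_not_exists (ι : BlowupVertex X s d ↪ V) (π : Fin s → Equiv.Perm X)
    {v : V} (h : ¬ ∃ w, ι w = v) : neighborList ι π v = [] := by
  rw [neighborList, dif_neg h]

theorem mem_neighborList (ι : BlowupVertex X s d ↪ V) (π : Fin s → Equiv.Perm X) (v u : V) :
    u ∈ neighborList ι π v ↔ ((blowup π d).map ι).Adj v u := by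
  rw [SimpleGraph.map_adj]
  by_cases h : ∃ w, ι w = v
  · obtain ⟨w, rfl⟩ := h
    rw [neighborList_apply, List.mem_map]
    simp only [mem_neighborsVia, EmbeddingLike.apply_eq_iff_eq]
    constructor
    · rintro ⟨w', h1, rfl⟩
      exact ⟨w, w', h1, rfl, rfl⟩
    · rintro ⟨w₁, w', h1, rfl, rfl⟩
      exact ⟨w', h1, rfl⟩
  · rw [neighborList_of_not_exists ι π h]
    simp only [List.not_mem_nil, false_iff, not_exists, not_and]
    intro w w' _ hw
    exact absurd ⟨w, hw⟩ h

theorem length_neighborList_le (ι : BlowupVertex X s d ↪ V) (π : Fin s → Equiv.Perm X) (v : V) :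
    (neighborList ι π v).length ≤ s * d + d := by
  by_cases h : ∃ w, ι w = v
  · obtain ⟨w, rfl⟩ := h
    rw [neighborList_apply, List.length_map]
    exact length_neighborsVia_le _ _
  · rw [neighborList_of_not_exists ι π h]
    simp

theorem nodup_neighborList (ι : BlowupVertex X s d ↪ V) (π : Fin s → Equiv.Perm X) (v : V) :
    (neighborList ι π v).Nodup := by
  by_cases h : ∃ w, ι w = v
  · obtain ⟨w, rfl⟩ := h
    rw [neighborList_apply]
    exact (nodup_neighborsVia _ _).map ι.injective
  · rw [neighborList_of_not_exists ι π h]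
    exact List.nodup_nil

open Classical in
theorem card_adj_le [Fintype V] (ι : BlowupVertex X s d ↪ V) (π : Fin s → Equiv.Perm X) (v : V) :
    (univ.filter fun u => ((blowup π d).map ι).Adj v u).card ≤ s * d + d := by
  refine (card_le_card (t := (neighborList ι π v).toFinset) fun u hu => ?_).trans
    ((List.toFinset_card_le _).trans (length_neighborList_le ι π v))
  rw [List.mem_toFinset, mem_neighborList]
  exact (mem_filter.1 hu).2

theorem degreeAtMost_blowup {n D : ℕ} (ι : BlowupVertex X s d ↪ Fin n)
    (π : Fin s → Equiv.Perm X) (hD : s * d + d ≤ D) : DegreeAtMost ((blowup π d).map ι) D := by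
  classical
  intro v
  refine le_trans ?_ ((card_adj_le ι π v).trans hD)
  rw [← Set.ncard_coe_finset]
  exact Set.ncard_le_ncard (fun u hu => by simpa using hu) (finite_toSet _)

theorem isNeighborOrder_neighborList {n : ℕ} (ι : BlowupVertex X s d ↪ Fin n)
    (π : Fin s → Equiv.Perm X) : IsNeighborOrder ((blowup π d).map ι) (neighborList ι π) :=
  fun v => ⟨nodup_neighborList ι π v, mem_neighborList ι π v⟩

/-- Each reply depends on at most one value of the permutations and their inverses. -/
def IsLocal {n : ℕ} (O : (Fin s → Equiv.Perm X) → Fin n → ℕ → Option (Fin n)) : Prop :=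
  ∀ v i, (∃ o, ∀ π, O π v i = o) ∨
    ∃ (e : Bool) (b : Fin s) (x : X) (g : X → Option (Fin n)), ∀ π, O π v i = g (partner π e b x)

/-- The neighbors over the same point do not depend on the permutations, and the others depend only
on the partner of this point for the block of the vertex. -/
theorem isLocal_neighborOracle {n : ℕ} (ι : BlowupVertex X s d ↪ Fin n) :
    IsLocal fun π => neighborOracle (neighborList ι π) := by
  intro v i
  by_cases h : ∃ w, ι w = v
  · obtain ⟨w, rfl⟩ := h
    refine Or.inr ⟨w.1, w.2.2.1, w.2.1, fun y => ((neighborsVia w y).map ι)[i]?, fun π => ?_⟩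
    simp only [neighborOracle, neighborList_apply]
  · refine Or.inl ⟨none, fun π => ?_⟩
    simp [neighborOracle, neighborList_of_not_exists ι π h]

end Oracle

/-! ### Blowups of color-respecting permutations are far from clusterable -/

section Far

variable {X : Type*} [Fintype X] [DecidableEq X] {s d : ℕ} {V : Type*} [Fintype V]

/-- Edges join vertices over points of equal color, so the color classes are unions of components.
One vertex over each point of side `true` already gives every class at least `M` vertices. -/
theorem isFar_blowup [DecidableEq V] {k dmax M : ℕ} {f gL gR : X → Fin (k + 1)}
    {π : Fin s → Equiv.Perm X} (hres : Respects gL gR π) (τ : Equiv.Perm X) (hgL : gL = f ∘ τ)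
    (hM : ∀ c, (univ.filter fun z => f z = c).card = M) (ι : BlowupVertex X s d ↪ V)
    (hs : 2 ≤ s) (hd : 1 ≤ d) (hk : 1 ≤ k) {ψin ψout ε : ℝ} (hψ : 0 < ψin) (hε : 0 ≤ ε)
    (hsmall : 2 * (2 * (ε * dmax * Fintype.card V) * (s * d + d : ℕ) * 2 ^ (s * d + d + 1)) <
      ψin * ((M : ℝ) / k - 2 * (ε * dmax * Fintype.card V) * ((s * d + d : ℕ) + 1))) :
    IsFar ((blowup π d).map ι) d k dmax ψin ψout ε := by
  classical
  let color (w : BlowupVertex X s d) : Fin (k + 1) := if w.1 then gL w.2.1 else gR w.2.1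
  have hcolor : ∀ w w', (blowup π d).Adj w w' → color w' = color w := by
    rintro ⟨e, x, b, a⟩ ⟨e', x', b', a'⟩ h
    simp only [blowup] at h
    rcases h with ⟨rfl, rfl, -⟩ | ⟨rfl, rfl, rfl⟩
    · rfl
    · cases e
      · have := hres b' ((π b')⁻¹ x)
        simp only [Equiv.Perm.inv_def, Equiv.apply_symm_apply] at this
        simp [color, partner, this]
      · simp [color, partner, hres b' x]
  refine isFar_of_classes (w := M) hd hk (fun v => ?_)
    (fun c => (univ.filter fun w => color w = c).map ι) ?_ ?_ ?_ ?_ hψ hε hsmall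
  · convert card_adj_le ι π v
  · intro c c' hcc
    rw [disjoint_map, disjoint_filter]
    rintro w _ rfl h
    exact hcc h
  · intro c v hv u hvu
    simp only [mem_map, mem_filter, mem_univ, true_and] at hv ⊢
    obtain ⟨w, hw, rfl⟩ := hv
    rw [SimpleGraph.map_adj] at hvu
    obtain ⟨w₁, w₂, h, h1, rfl⟩ := hvu
    rw [ι.injective h1] at h
    exact ⟨w₂, (hcolor _ _ h).trans hw, rfl⟩
  · intro c v hv
    obtain ⟨w, -, rfl⟩ := mem_map.1 hv
    have hcov := isCellCover_cell π ι hs hd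
    have hmem : ι w ∈ cell π ι (.inl (w.1, w.2.1)) := apply_mem_cell.2 ⟨rfl, rfl⟩
    obtain ⟨Q, h1, h2, h3⟩ := exists_subsuperset_card_eq (singleton_subset_iff.2 hmem)
      (n := d + 1) (by simp) (hcov.lt_card _)
    exact ⟨Q, isNClique_of_subset (hcov.isClique _) h2 h3, singleton_subset_iff.1 h1⟩
  · intro c
    rw [card_map, ← hM c]
    have h1 : (univ.filter fun z => f z = c).card = (univ.filter fun z => f (τ z) = c).card :=
      (card_equiv τ (by simp)).symm
    rw [h1]
    refine card_le_card_of_injOn (fun x => (true, x, ⟨0, by omega⟩, ⟨0, by omega⟩))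
      (fun x hx => ?_) (fun x _ y _ hxy => by simpa using hxy)
    simpa [color, hgL] using hx

end Far

/-! ### Comparison of acceptance counts along a decision tree -/

section DecisionTree

variable {X : Type*} [DecidableEq X] {s n : ℕ}

/-- The triple that records the value `y` of a permutation or an inverse at `x`. -/
def record (e : Bool) (b : Fin s) (x y : X) : Fin s × X × X :=
  if e then (b, x, y) else (b, y, x)

theorem extends_insert_record {R : Finset (Fin s × X × X)} {e : Bool} {b : Fin s} {x y : X}
    {π : Fin s → Equiv.Perm X} :
    Extends (insert (record e b x y) R) π ↔ Extends R π ∧ partner π e b x = y := by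
  have : Extends (insert (record e b x y) R) π ↔
      π (record e b x y).1 (record e b x y).2.1 = (record e b x y).2.2 ∧ Extends R π := by
    simp [Extends]
  rw [this, and_comm, and_congr_right_iff]
  intro _
  cases e
  · simp only [record, partner, Bool.false_eq_true, if_false, Equiv.Perm.inv_def]
    exact ⟨fun h => by rw [← h, Equiv.symm_apply_apply],
      fun h => by rw [← h, Equiv.apply_symm_apply]⟩
  · simp [record, partner]

variable [Fintype X]

-- Induction on the tree, with `R` the values revealed so far. A local query splits both counts
-- according to the revealed value `y`, and at a leaf `card_extends_le_coloredPerms` applies.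
open Classical in
theorem card_run_le {k M q : ℕ} {f : X → Fin (k + 1)}
    (hM : ∀ c, (univ.filter fun z => f z = c).card = M) (hq : 12 * q ^ 2 ≤ M) (hM0 : 0 < M)
    {O : (Fin s → Equiv.Perm X) → Fin n → ℕ → Option (Fin n)} (hO : IsLocal O) (t : QueryAlg n) :
    ∀ (R : Finset (Fin s × X × X)) (p : ℕ), R.card + p ≤ q →
      (∀ π, Extends R π → t.queries (O π) ≤ p) →
      3 * ((univ.filter fun π => Extends R π ∧ t.run (O π) = true).card *
        (coloredPerms (Fin s) f).card) ≤
      4 * (((coloredPerms (Fin s) f).filter fun ω => Extends R ω.2 ∧ t.run (O ω.2) = true).card *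
        Fintype.card (Fin s → Equiv.Perm X)) := by
  induction t with
  | output b =>
    intro R p hp _
    cases b
    · simp [QueryAlg.run]
    · simp only [QueryAlg.run, and_true]
      exact card_extends_le_coloredPerms (fun c => by convert hM c) R (by omega) hq hM0
  | query v i next ih =>
    intro R p hp hqueries
    -- A permutation family extending `R` shows that `p ≥ 1` at a query node. If there is none, the
    -- left side is `0`.
    by_cases hex : ∃ π, Extends R π
    · obtain ⟨π₀, hπ₀⟩ := hex
      have hp0 := hqueries π₀ hπ₀
      simp only [QueryAlg.queries] at hp0 hqueries
      simp only [QueryAlg.run]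
      rcases hO v i with ⟨o, ho⟩ | ⟨e, b, x, g, hg⟩
      · simp only [ho] at hqueries ⊢
        exact ih o R (p - 1) (by omega) fun π hπ => by have := hqueries π hπ; omega
      · simp only [hg] at hqueries ⊢
        have hy := fun y => ih (g y) (insert (record e b x y) R) (p - 1)
          (by have := card_insert_le (record e b x y) R; omega)
          (fun π hπ => by
            rw [extends_insert_record] at hπ
            have := hqueries π hπ.1
            rw [hπ.2] at this
            omega)
        have hyes : (univ.filter fun π : Fin s → Equiv.Perm X =>
            Extends R π ∧ (next (g (partner π e b x))).run (O π) = true).card =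
            ∑ y, (univ.filter fun π => Extends (insert (record e b x y) R) π ∧
              (next (g y)).run (O π) = true).card := by
          rw [card_eq_sum_card_fiberwise (f := fun π => partner π e b x) (t := univ)
            (fun _ _ => mem_coe.2 (mem_univ _))]
          refine sum_congr rfl fun y _ => congrArg card ?_
          ext π
          simp only [mem_filter, mem_univ, true_and, extends_insert_record]
          constructor
          · rintro ⟨⟨h1, h2⟩, rfl⟩
            exact ⟨⟨h1, rfl⟩, h2⟩
          · rintro ⟨⟨h1, rfl⟩, h2⟩
            exact ⟨⟨h1, h2⟩, rfl⟩
        have hno : ((coloredPerms (Fin s) f).filter fun ω =>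
            Extends R ω.2 ∧ (next (g (partner ω.2 e b x))).run (O ω.2) = true).card =
            ∑ y, ((coloredPerms (Fin s) f).filter fun ω =>
              Extends (insert (record e b x y) R) ω.2 ∧
              (next (g y)).run (O ω.2) = true).card := by
          rw [card_eq_sum_card_fiberwise (f := fun ω => partner ω.2 e b x) (t := univ)
            (fun _ _ => mem_coe.2 (mem_univ _))]
          refine sum_congr rfl fun y _ => congrArg card ?_
          ext ω
          simp only [mem_filter, extends_insert_record]
          constructor
          · rintro ⟨⟨h0, h1, h2⟩, rfl⟩
            exact ⟨h0, ⟨h1, rfl⟩, h2⟩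
          · rintro ⟨h0, ⟨h1, rfl⟩, h2⟩
            exact ⟨⟨h0, h1, h2⟩, rfl⟩
        rw [hyes, hno, sum_mul, sum_mul, mul_sum, mul_sum]
        exact sum_le_sum fun y _ => hy y
    · have : (univ.filter fun π => Extends R π ∧ (QueryAlg.query v i next).run (O π) = true) = ∅ := by
        rw [filter_eq_empty_iff]
        intro π _ h
        exact hex ⟨π, h.1⟩
      rw [this]
      simp

end DecisionTree

/-! ### From decision trees to randomized testers -/

section Probability

open Classical in
theorem sum_map_apply_true {α β : Type*} (T : PMF β) (S : Finset α) (F : α → β → Bool) :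
    ∑ x ∈ S, (T.map (F x)) true = ∑' t, T t * ((S.filter fun x => F x t = true).card : ENNReal) := by
  simp only [PMF.map_apply]
  rw [← Summable.tsum_finsetSum fun _ _ => ENNReal.summable]
  refine tsum_congr fun t => ?_
  rw [card_filter, Nat.cast_sum, mul_sum]
  refine sum_congr rfl fun x _ => ?_
  by_cases h : F x t = true <;> simp [h]

theorem three_mul_map_true_le {β : Type*} (T : PMF β) (F : β → Bool)
    (h : (2 / 3 : ENNReal) ≤ (T.map F) false) : 3 * (T.map F) true ≤ 1 := by
  have h1 : (T.map F) false + (T.map F) true = 1 := by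
    rw [← (T.map F).tsum_coe, tsum_bool]
  have h2 : (2 : ENNReal) ≤ 3 * (T.map F) false := by
    calc (2 : ENNReal) = 3 * (2 / 3) := (ENNReal.mul_div_cancel (by simp) (by simp)).symm
      _ ≤ _ := by gcongr
  have h3 : 2 + 3 * (T.map F) true ≤ 2 + 1 := by
    calc 2 + 3 * (T.map F) true ≤ 3 * (T.map F) false + 3 * (T.map F) true := by gcongr
      _ = 3 := by rw [← mul_add, h1, mul_one]
      _ = 2 + 1 := by norm_num
  exact (ENNReal.add_le_add_iff_left (by simp)).1 h3

open Classical in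
/-- A randomized algorithm that accepts with probability at least `2/3` for all `x ∈ E` and with
probability at most `1/3` for all `ω ∈ S'` notices the difference between `S` and `S'`. -/
theorem two_mul_card_le_of_tester {α α' β : Type*} (T : PMF β) {S E : Finset α} {S' : Finset α'}
    (hE : E ⊆ S) (F : α → β → Bool) (F' : α' → β → Bool)
    (hacc : ∀ x ∈ E, (2 / 3 : ENNReal) ≤ (T.map (F x)) true)
    (hrej : ∀ x ∈ S', (2 / 3 : ENNReal) ≤ (T.map (F' x)) false)
    (hle : ∀ t ∈ T.support, 3 * ((S.filter fun x => F x t = true).card * S'.card) ≤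
      4 * ((S'.filter fun x => F' x t = true).card * S.card)) (hS' : 0 < S'.card) :
    3 * E.card ≤ 2 * S.card := by
  -- The comparison for each deterministic algorithm is averaged over the coins.
  have h1 : 3 * S'.card * ∑ x ∈ S, (T.map (F x)) true ≤
      4 * S.card * ∑ x ∈ S', (T.map (F' x)) true := by
    rw [sum_map_apply_true, sum_map_apply_true, ← ENNReal.tsum_mul_left, ← ENNReal.tsum_mul_left]
    refine ENNReal.tsum_le_tsum fun t => ?_
    by_cases ht : t ∈ T.support
    · have h2 : (3 * ((S.filter fun x => F x t = true).card * S'.card) : ENNReal) ≤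
        4 * ((S'.filter fun x => F' x t = true).card * S.card) := by exact_mod_cast hle t ht
      calc _ = T t * (3 * ((S.filter fun x => F x t = true).card * S'.card)) := by ring
        _ ≤ T t * (4 * ((S'.filter fun x => F' x t = true).card * S.card)) := by gcongr
        _ = _ := by ring
    · rw [PMF.mem_support_iff, not_not] at ht
      simp [ht]
  have hyes : (2 * E.card : ENNReal) ≤ 3 * ∑ x ∈ S, (T.map (F x)) true := by
    calc (2 * E.card : ENNReal) = ∑ x ∈ E, 3 * (2 / 3 : ENNReal) := by
          rw [ENNReal.mul_div_cancel (by simp) (by simp), sum_const, nsmul_eq_mul, mul_comm]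
      _ ≤ ∑ x ∈ E, 3 * (T.map (F x)) true := by
          refine sum_le_sum fun x hx => ?_
          gcongr
          exact hacc x hx
      _ ≤ ∑ x ∈ S, 3 * (T.map (F x)) true := sum_le_sum_of_subset hE
      _ = _ := (mul_sum _ _ _).symm
  have hno : 3 * ∑ x ∈ S', (T.map (F' x)) true ≤ (S'.card : ENNReal) := by
    rw [mul_sum]
    calc _ ≤ ∑ x ∈ S', (1 : ENNReal) :=
          sum_le_sum fun x hx => three_mul_map_true_le T _ (hrej x hx)
      _ = _ := by simp
  have h3 : (3 * S'.card * (2 * E.card) : ENNReal) ≤ 4 * S.card * S'.card := by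
    calc (3 * S'.card * (2 * E.card) : ENNReal)
        ≤ 3 * S'.card * (3 * ∑ x ∈ S, (T.map (F x)) true) := by gcongr
      _ = 3 * (3 * S'.card * ∑ x ∈ S, (T.map (F x)) true) := by ring
      _ ≤ 3 * (4 * S.card * ∑ x ∈ S', (T.map (F' x)) true) := by gcongr
      _ = 4 * S.card * (3 * ∑ x ∈ S', (T.map (F' x)) true) := by ring
      _ ≤ _ := by gcongr
  have h4 : 3 * S'.card * (2 * E.card) ≤ 4 * S.card * S'.card := by exact_mod_cast h3
  refine Nat.le_of_mul_le_mul_left (c := 2 * S'.card) ?_ (by omega)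
  linarith

end Probability

/-! ### Assembly of the lower bound and choice of constants -/

theorem card_fst_fiber (k M : ℕ) (c : Fin (k + 1)) :
    (univ.filter fun z : Fin (k + 1) × Fin M => z.1 = c).card = M := by
  have : (univ.filter fun z : Fin (k + 1) × Fin M => z.1 = c) = {c} ×ˢ univ := by
    ext ⟨a, b⟩
    simp [eq_comm]
  rw [this, card_product, card_singleton, card_univ, Fintype.card_fin, one_mul]

theorem lt_of_isClusterabilityTester {d k dmax M n q : ℕ} (hd : 1 ≤ d) (hk : 1 ≤ k)
    (ι : BlowupVertex (Fin (k + 1) × Fin M) 24 d ↪ Fin n) (hM : 0 < M)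
    (hdmax : 24 * d + d ≤ dmax) {ψin ψout ε : ℝ} (hψ0 : 0 < ψin)
    (hψ : ψin ≤ 1 / ((d : ℝ) * (2 * 4 ^ (24 * d) * (5 * 24 + 4 + 1) : ℕ))) (hout : 0 ≤ ψout)
    (hε : 0 ≤ ε)
    (hsmall : 2 * (2 * (ε * dmax * n) * (24 * d + d : ℕ) * 2 ^ (24 * d + d + 1)) <
      ψin * ((M : ℝ) / k - 2 * (ε * dmax * n) * ((24 * d + d : ℕ) + 1)))
    {T : PMF (QueryAlg n)} (hT : IsClusterabilityTester T d k dmax ψin ψout ε)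
    (hq : MakesAtMostQueries T dmax q) : M < 12 * q ^ 2 := by
  classical
  by_contra! hqM
  let f : Fin (k + 1) × Fin M → Fin (k + 1) := Prod.fst
  have hX : 2 ≤ Fintype.card (Fin (k + 1) × Fin M) := by
    simp only [Fintype.card_prod, Fintype.card_fin]
    nlinarith
  let O (π : Fin 24 → Equiv.Perm (Fin (k + 1) × Fin M)) := neighborOracle (neighborList ι π)
  have hexp := card_isExpanding_ge (X := Fin (k + 1) × Fin M)
  have hcolored : 0 < (coloredPerms (Fin 24) f).card := by
    refine card_pos.2 ⟨((1, 1), 1), ?_⟩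
    simp [coloredPerms, Respects]
  have := two_mul_card_le_of_tester T (S := univ) (S' := coloredPerms (Fin 24) f)
    (subset_univ (univ.filter fun π : Fin 24 → Equiv.Perm (Fin (k + 1) × Fin M) =>
        IsExpanding π ∧ IsExpanding fun b => (π b)⁻¹))
    (fun π => QueryAlg.run (O π)) (fun ω => QueryAlg.run (O ω.2)) ?_ ?_ ?_ hcolored
  -- At least `3/4` of the families expand, whereas the comparison would leave at most `2/3`.
  · rw [card_univ] at this
    have hpos : 0 < Fintype.card (Fin 24 → Equiv.Perm (Fin (k + 1) × Fin M)) := Fintype.card_pos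
    omega
  · intro π hπ
    obtain ⟨h1, h2⟩ := (mem_filter.1 hπ).2
    exact (hT _ _ (degreeAtMost_blowup ι π hdmax) (isNeighborOrder_neighborList ι π)).1
      (hasCluster_blowup h1 h2 hX ι (by norm_num) hd hk (by exact_mod_cast hψ) hout)
  · intro ω hω
    have hres := (mem_filter.1 hω).2
    refine (hT _ _ (degreeAtMost_blowup ι ω.2 hdmax) (isNeighborOrder_neighborList ι ω.2)).2
      (isFar_blowup hres ω.1.1 rfl (card_fst_fiber k M) ι (by norm_num) hd hk hψ0 hε ?_)
    rw [Fintype.card_fin]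
    exact hsmall
  · intro t ht
    have h := card_run_le (f := f) (card_fst_fiber k M) hqM hM (isLocal_neighborOracle ι) t ∅ q
      (by simp) fun π _ =>
        hq _ _ (degreeAtMost_blowup ι π hdmax) (isNeighborOrder_neighborList ι π) t ht
    simp only [Extends, notMem_empty, IsEmpty.forall_iff, implies_true, true_and] at h
    rw [card_univ]
    exact h

end HigherOrderClusterability

open HigherOrderClusterability in
theorem theorem3 (d : ℕ) (hd : 1 ≤ d) :
    ∃ D₀ : ℕ, ∃ ψ₀ : ℝ, 0 < ψ₀ ∧
      ∀ k : ℕ, 1 ≤ k → ∃ c : ℝ, 0 < c ∧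
        ∀ dmax : ℕ, D₀ ≤ dmax → ∀ ψin : ℝ, 0 < ψin → ψin ≤ ψ₀ →
          ∃ ε₀ : ℝ, 0 < ε₀ ∧ ∀ ε : ℝ, 0 < ε → ε ≤ ε₀ →
            ∃ N : ℕ, ∀ n : ℕ, N ≤ n → ∀ ψout : ℝ, 0 ≤ ψout →
              ∀ (T : PMF (HigherOrderClusterability.QueryAlg n)) (q : ℕ),
                HigherOrderClusterability.IsClusterabilityTester T d k dmax ψin ψout ε →
                HigherOrderClusterability.MakesAtMostQueries T dmax q →
                c * Real.sqrt n ≤ q := by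
  refine ⟨24 * d + d, 1 / ((d : ℝ) * (2 * 4 ^ (24 * d) * (5 * 24 + 4 + 1) : ℕ)), by positivity,
    fun k hk => ?_⟩
  -- The blowup has `2 * (k + 1) * M * 24 * d = β * M` vertices.
  set β : ℕ := 48 * d * (k + 1) with hβ
  have hβ0 : 0 < β := by positivity
  have hβr : (1 : ℝ) ≤ β := by exact_mod_cast hβ0
  -- From `n ≤ 2 * β * M` and `M < 12 * q ^ 2` follows `n < 24 * β * q ^ 2`; the constant `1 / (24 *
  -- β)` is below the square root of `1 / (24 * β)`.
  refine ⟨1 / (24 * β), by positivity, fun dmax hdmax ψin hψ0 hψ => ?_⟩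
  -- `Z` collects the coefficients of `ε * dmax * n` in `hsmall`, which thus becomes `ε * dmax * n *
  -- Z < ψin * (M / k)`.
  set Z : ℝ := 4 * (24 * d + d : ℕ) * 2 ^ (24 * d + d + 1) +
    ψin * 2 * ((24 * d + d : ℕ) + 1) with hZ
  have hZ0 : 0 < Z := by positivity
  have hk0 : (0 : ℝ) < k := by exact_mod_cast hk
  refine ⟨ψin / (k * (Z + 1) * (dmax * (2 * β) + 1)), by positivity, fun ε hε hε₀ =>
    ⟨β, fun n hn ψout hout T q hT hq => ?_⟩⟩
  set M := n / β with hM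
  have hM0 : 0 < M := Nat.div_pos hn hβ0
  have hMn : β * M ≤ n := Nat.mul_div_le n β
  have hnM : n ≤ 2 * β * M := by
    have := Nat.lt_mul_div_succ n hβ0
    rw [← hM] at this
    nlinarith
  have hnMr : (n : ℝ) ≤ 2 * β * M := by exact_mod_cast hnM
  have hMr : (0 : ℝ) < M := by exact_mod_cast hM0
  obtain ⟨ι⟩ : Nonempty (BlowupVertex (Fin (k + 1) × Fin M) 24 d ↪ Fin n) := by
    refine Function.Embedding.nonempty_of_card_le ?_
    simp only [Fintype.card_prod, Fintype.card_bool, Fintype.card_fin]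
    refine le_trans (le_of_eq ?_) hMn
    rw [hβ]
    ring
  have hx : ε * dmax * n * (k * (Z + 1)) < ψin * M := by
    rw [le_div_iff₀ (by positivity)] at hε₀
    calc ε * dmax * n * (k * (Z + 1)) ≤ ε * dmax * (2 * β * M) * (k * (Z + 1)) := by gcongr
      _ = ε * (k * (Z + 1) * (dmax * (2 * β))) * M := by ring
      _ < ε * (k * (Z + 1) * (dmax * (2 * β) + 1)) * M := by gcongr; linarith
      _ ≤ _ := by gcongr
  have hsmall : 2 * (2 * (ε * dmax * n) * (24 * d + d : ℕ) * 2 ^ (24 * d + d + 1)) <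
      ψin * ((M : ℝ) / k - 2 * (ε * dmax * n) * ((24 * d + d : ℕ) + 1)) := by
    have h1 : ε * dmax * n * Z < ψin * ((M : ℝ) / k) := by
      rw [← mul_div_assoc, lt_div_iff₀ hk0]
      refine lt_of_le_of_lt ?_ hx
      have : 0 ≤ ε * dmax * n * k := by positivity
      linarith
    rw [hZ] at h1
    linarith
  have hlt := lt_of_isClusterabilityTester hd hk ι hM0 hdmax hψ0 hψ hout hε.le hsmall hT hq
  have hltr : (M : ℝ) < 12 * q ^ 2 := by exact_mod_cast hlt
  refine le_of_sq_le_sq ?_ (Nat.cast_nonneg q)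
  rw [mul_pow, Real.sq_sqrt (Nat.cast_nonneg n), div_pow, one_pow, one_div_mul_eq_div,
    div_le_iff₀ (by positivity)]
  nlinarith [mul_pos (sub_pos.2 hltr) (show (0 : ℝ) < β by linarith),
    mul_nonneg (sub_nonneg.2 hβr) (show (0 : ℝ) ≤ q ^ 2 * β by positivity)]
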